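/- **Setting.** Let $N\ge 1$, let $\Omega\subset\mathbf{R}^N$ be a bounded domain (open, connected), and let $B\subset\Omega$ be closed in $\mathbf{R}^N$ with finitely many connected components $B_1,\dots,B_m$ ($m\ge 0$), each of positive Lebesgue measure $|B_l|$. Set $A:=\Omega\setminus B$. (No regularity of $\partial\Omega$ or $\partial B_l$ is needed; the statement covers in particular a $C^1$ boundary $\partial\Omega$ and piecewise $C^1$ boundaries $\partial B_l$.) Let $$\mathcal{H}:=\Big\{u\in L^2(\Omega)\ :\ u(x)=\tfrac1{|B_l|}\int_{B_l}u(y)\,dy\ \text{ for a.e. }x\in B_l,\ l=1,\dots,m\Big\},\qquad \mathcal{V}:=\mathcal{H}\cap H^1_0(\Omega),$$ with the norms of $L^2(\Omega)$ and $H^1(\Omega)$ respectively, $H^1_0(\Omega)$ being the closure of $C_c^\infty(\Omega)$ in $H^1(\Omega)$; an element $u\in\mathcal{H}$ is identified with the functional $L_u\in\mathcal{V}'$, $L_u(w)=\int_\Omega uw\,dx$. Let $M:A\to M_N(\mathbf{R})$ be a measurable matrix field, not necessarily symmetric, such that $M_{ij}\in L^\infty(A)$ for all $i,j$ and such that for some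 $\alpha>0$ $$\xi\cdot M(x)\xi\ge\alpha|\xi|^2\quad\text{for a.e. }x\in A\text{ and all }\xi\in\mathbf{R}^N.$$ The limit diffusion problem with initial datum $\rho^{in}\in\mathcal{H}$ is $$\left\{\begin{aligned} &\partial_t\rho=\operatorname{div}_x(M\nabla_x\rho) &&\text{in }(0,\infty)\times A,\\ &\rho=0 &&\text{on }(0,\infty)\times\partial\Omega,\\ &\rho(t,x)=\rho_l(t) &&x\in\partial B_l,\ t>0,\ l=1,\dots,m,\\ &\dot\rho_l(t)=\tfrac1{|B_l|}\int_{\partial B_l}\sum_{i,j}M_{ij}n_{x,i}\partial_{x_j}\rho(t,x)\,d\sigma(x) &&t>0,\ l=1,\dots,m,\\ &\rho(0,\cdot)=\rho^{in} &&\text{in }\Omega \end{aligned}\right.$$ ($n_x$ being the unit normal pointing out of $A$). A *weak solution* of it is, by definition, a function $\rho\in C_b(\mathbf{R}_+;\mathcal{H})\cap L^2(\mathbf{R}_+;\mathcal{V})$ with $\partial_t\rho\in L^2(\mathbf{R}_+;\mathcal{V}')$ (derivative in the sense of $\mathcal{V}'$-valued distributions on $(0,\infty)$), $\rho(0)=\rho^{in}$,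 and, for all $w\in\mathcal{V}$, $$\frac{d}{dt}\int_\Omega\rho(t,x)w(x)\,dx+\int_A\nabla w(x)\cdot M(x)\nabla_x\rho(t,x)\,dx=0\quad\text{for a.e. }t\ge 0.$$ **Proposition.** For each $\rho^{in}\in\mathcal{H}$, the limit diffusion problem has a unique weak solution $\rho$. This solution satisfies, for each $t\ge 0$, the energy identity $$\tfrac12\int_\Omega\rho(t,x)^2\,dx+\int_0^t\int_A\nabla_x\rho(s,x)\cdot M(x)\nabla_x\rho(s,x)\,dx\,ds=\tfrac12\int_\Omega\rho^{in}(x)^2\,dx.$$ -/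

import Mathlib

open MeasureTheory Set TopologicalSpace
open scoped NNReal ENNReal BoundedContinuousFunction Distributions

noncomputable section

/-- The geometric setting: a bounded domain `Ω` of `ℝ^N` and a closed set `B ⊆ Ω` whose connected
components are `B_1, …, B_m`. (For pairwise disjoint closed connected sets, finite in number, these
sets are exactly the connected components of their union.) -/
structure DiffusionDomain (N : ℕ) where
  /-- the domain -/
  Ω : Opens (EuclideanSpace ℝ (Fin N))
  isConnected_Ω : IsConnected (Ω : Set (EuclideanSpace ℝ (Fin N)))
  isBounded_Ω : Bornology.IsBounded (Ω : Set (EuclideanSpace ℝ (Fin N)))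
  /-- the number of connected components of `B` -/
  m : ℕ
  /-- the connected components of `B` -/
  B : Fin m → Set (EuclideanSpace ℝ (Fin N))
  isClosed_B : ∀ l, IsClosed (B l)
  isConnected_B : ∀ l, IsConnected (B l)
  disjoint_B : ∀ k l, k ≠ l → Disjoint (B k) (B l)
  B_subset_Ω : ∀ l, B l ⊆ Ω
  volume_B_pos : ∀ l, 0 < volume (B l)

namespace DiffusionDomain

variable {N : ℕ} (D : DiffusionDomain N)

/-- The diffusive region `A = Ω \ B`. -/
def A : Set (EuclideanSpace ℝ (Fin N)) := (D.Ω : Set (EuclideanSpace ℝ (Fin N))) \ ⋃ l, D.B l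

/-- `L²(Ω)`. -/
abbrev L2 : Type :=
  Lp ℝ 2 (volume.restrict (D.Ω : Set (EuclideanSpace ℝ (Fin N))))

/-- `L²(Ω; ℝ^N)`. -/
abbrev L2Vec : Type :=
  Lp (EuclideanSpace ℝ (Fin N)) 2 (volume.restrict (D.Ω : Set (EuclideanSpace ℝ (Fin N))))

/-- Pairs `(u, g)` with norm `‖(u, g)‖² = ‖u‖² + ‖g‖²`. A Sobolev function `u ∈ H¹(Ω)` is
represented by the pair `(u, ∇u)`, and the norm of the pair is the `H¹` norm of `u`. -/
abbrev L2Pair : Type := WithLp 2 (D.L2 × D.L2Vec)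

/-- `g` is the weak gradient of `u` in `Ω`: `∫_Ω u ∂_v φ = - ∫_Ω (g · v) φ` for all test functions
`φ ∈ C_c^∞(Ω)` and all directions `v`. -/
def HasWeakGradient (u : D.L2) (g : D.L2Vec) : Prop :=
  ∀ (φ : 𝓓(D.Ω, ℝ)) (v : EuclideanSpace ℝ (Fin N)),
    ∫ x in (D.Ω : Set (EuclideanSpace ℝ (Fin N))), u x * fderiv ℝ φ x v
      = - ∫ x in (D.Ω : Set (EuclideanSpace ℝ (Fin N))), inner ℝ (g x) v * φ x

/-- The pairs `(φ, ∇φ)` with `φ ∈ C_c^∞(Ω)`. -/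
def testPairs : Set D.L2Pair :=
  {p | ∃ φ : 𝓓(D.Ω, ℝ),
    (∀ᵐ x ∂(volume.restrict (D.Ω : Set (EuclideanSpace ℝ (Fin N)))), p.fst x = φ x) ∧
    (∀ᵐ x ∂(volume.restrict (D.Ω : Set (EuclideanSpace ℝ (Fin N)))), p.snd x = gradient φ x)}

/-- `H¹₀(Ω)`, the closure of `C_c^∞(Ω)` for the `H¹` norm; an element is a pair `(u, ∇u)`, see
`hasWeakGradient_of_mem_H10`. (The set `testPairs` is already a linear subspace.) -/
def H10 : Submodule ℝ D.L2Pair := (Submodule.span ℝ D.testPairs).topologicalClosure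

/-- The second component of an element of `H¹₀(Ω)` is the weak gradient of the first. -/
theorem hasWeakGradient_of_mem_H10 {p : D.L2Pair} (hp : p ∈ D.H10) :
    D.HasWeakGradient p.fst p.snd := by
  intro φ v
  have hφc : Continuous φ := φ.continuous
  have hφd : ContDiff ℝ 1 φ := φ.contDiff.of_le (by simp)
  have hdc : Continuous (fun x => fderiv ℝ φ x v) :=
    (hφd.continuous_fderiv (by simp)).clm_apply continuous_const
  have hds : HasCompactSupport (fun x => fderiv ℝ φ x v) :=
    φ.hasCompactSupport.fderiv_apply (𝕜 := ℝ) v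
  have h1 : MemLp (fun x => fderiv ℝ φ x v) 2
      (volume.restrict (D.Ω : Set (EuclideanSpace ℝ (Fin N)))) :=
    (hdc.memLp_of_hasCompactSupport hds).restrict _
  have h2 : MemLp (fun x => φ x • v) 2
      (volume.restrict (D.Ω : Set (EuclideanSpace ℝ (Fin N)))) :=
    ((hφc.smul continuous_const).memLp_of_hasCompactSupport
      (φ.hasCompactSupport.smul_right)).restrict _
  let F : D.L2Pair → ℝ := fun q => inner ℝ (h1.toLp _) q.fst + inner ℝ (h2.toLp _) q.snd
  have hF : ∀ q : D.L2Pair, F q =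
      (∫ x in (D.Ω : Set (EuclideanSpace ℝ (Fin N))), q.fst x * fderiv ℝ φ x v)
      + ∫ x in (D.Ω : Set (EuclideanSpace ℝ (Fin N))), inner ℝ (q.snd x) v * φ x := by
    intro q
    simp only [F, L2.inner_def]
    congr 1
    · apply integral_congr_ae
      filter_upwards [h1.coeFn_toLp] with x hx
      rw [hx]; simp
    · apply integral_congr_ae
      filter_upwards [h2.coeFn_toLp] with x hx
      rw [hx, real_inner_smul_left, real_inner_comm, mul_comm]
  let Fl : D.L2Pair →L[ℝ] ℝ :=
    (innerSL ℝ (h1.toLp _)).comp (WithLp.fstL 2 ℝ D.L2 D.L2Vec)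
      + (innerSL ℝ (h2.toLp _)).comp (WithLp.sndL 2 ℝ D.L2 D.L2Vec)
  have hker : D.H10 ≤ LinearMap.ker (Fl : D.L2Pair →ₗ[ℝ] ℝ) := by
    refine Submodule.topologicalClosure_minimal _ (Submodule.span_le.2 ?_)
      Fl.isClosed_ker
    rintro q ⟨ψ, hq1, hq2⟩
    change F q = 0
    rw [hF q]
    have hψd : ContDiff ℝ 1 ψ := ψ.contDiff.of_le (by simp)
    have e1 : ∫ x in (D.Ω : Set (EuclideanSpace ℝ (Fin N))), q.fst x * fderiv ℝ φ x v
        = ∫ x, ψ x * fderiv ℝ φ x v := by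
      rw [← setIntegral_eq_integral_of_forall_compl_eq_zero (μ := volume) (f := fun x => ψ x * fderiv ℝ φ x v)
        (s := (D.Ω : Set (EuclideanSpace ℝ (Fin N))))]
      · apply integral_congr_ae
        filter_upwards [hq1] with x hx
        rw [hx]
      · intro x hx
        rw [image_eq_zero_of_notMem_tsupport (fun h => hx (ψ.tsupport_subset h)), zero_mul]
    have e2 : ∫ x in (D.Ω : Set (EuclideanSpace ℝ (Fin N))), inner ℝ (q.snd x) v * φ x
        = ∫ x, fderiv ℝ ψ x v * φ x := by
      rw [← setIntegral_eq_integral_of_forall_compl_eq_zero (μ := volume) (f := fun x => fderiv ℝ ψ x v * φ x)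
        (s := (D.Ω : Set (EuclideanSpace ℝ (Fin N))))]
      · apply integral_congr_ae
        filter_upwards [hq2] with x hx
        rw [hx, gradient, InnerProductSpace.toDual_symm_apply]
      · intro x hx
        rw [image_eq_zero_of_notMem_tsupport (f := φ) (fun h => hx (φ.tsupport_subset h)),
          mul_zero]
    have hψdc : Continuous (fun x => fderiv ℝ ψ x v) :=
      (hψd.continuous_fderiv (by simp)).clm_apply continuous_const
    rw [e1, e2, integral_mul_fderiv_eq_neg_fderiv_mul_of_integrable]
    · ring
    · exact (hψdc.mul hφc).integrable_of_hasCompactSupport φ.hasCompactSupport.mul_left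
    · exact (ψ.continuous.mul hdc).integrable_of_hasCompactSupport hds.mul_left
    · exact (ψ.continuous.mul hφc).integrable_of_hasCompactSupport φ.hasCompactSupport.mul_left
    · intro x _
      exact (hψd.differentiable (by simp)) x
    · intro x _
      exact (hφd.differentiable (by simp)) x
  have h0 : F p = 0 := hker hp
  rw [hF p] at h0
  linarith

/-- `𝓗`: the functions `u ∈ L²(Ω)` such that, for each `l`, `u(x)` equals the mean value of `u`
over `B_l` for a.e. `x ∈ B_l`. -/
def H : Submodule ℝ D.L2 where
  carrier := {u | ∀ l, ∀ᵐ x ∂(volume.restrict (D.B l)), u x = ⨍ y in D.B l, u y}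
  zero_mem' := by
    intro l
    have h0 : ∀ᵐ x ∂(volume.restrict (D.B l)), (0 : D.L2) x = 0 :=
      ae_mono (Measure.restrict_mono (D.B_subset_Ω l) le_rfl) (Lp.coeFn_zero ℝ 2 _)
    have : ⨍ y in D.B l, (0 : D.L2) y = 0 := by
      rw [average_congr h0]; simp [average]
    filter_upwards [h0] with x hx
    rw [hx, this]
  add_mem' := by
    intro u w hu hw l
    have hfin : volume (D.B l) < ∞ :=
      (D.isBounded_Ω.subset (D.B_subset_Ω l)).measure_lt_top
    have : IsFiniteMeasure (volume.restrict (D.B l)) := ⟨by simpa using hfin⟩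
    have hi : ∀ z : D.L2, Integrable z (volume.restrict (D.B l)) := fun z =>
      ((Lp.memLp z).mono_measure
        (Measure.restrict_mono (D.B_subset_Ω l) le_rfl)).integrable (by norm_num)
    have hadd : ∀ᵐ x ∂(volume.restrict (D.B l)), (u + w : D.L2) x = u x + w x :=
      ae_mono (Measure.restrict_mono (D.B_subset_Ω l) le_rfl) (Lp.coeFn_add u w)
    have hav : ⨍ y in D.B l, (u + w : D.L2) y = (⨍ y in D.B l, u y) + ⨍ y in D.B l, w y := by
      rw [average_congr hadd]
      simp only [average_eq]
      rw [integral_add (hi u) (hi w), smul_add]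
    filter_upwards [hadd, hu l, hw l] with x h1 h2 h3
    rw [h1, hav, h2, h3]
  smul_mem' := by
    intro c u hu l
    have hsm : ∀ᵐ x ∂(volume.restrict (D.B l)), (c • u : D.L2) x = c * u x := by
      have := ae_mono (Measure.restrict_mono (D.B_subset_Ω l) le_rfl) (Lp.coeFn_smul c u)
      filter_upwards [this] with x hx
      rw [hx]; simp
    have hav : ⨍ y in D.B l, (c • u : D.L2) y = c * ⨍ y in D.B l, u y := by
      rw [average_congr hsm]
      simp only [average_eq, integral_const_mul, smul_eq_mul]
      ring
    filter_upwards [hsm, hu l] with x h1 h2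
    rw [h1, hav, ← h2]

/-- `𝓥 = 𝓗 ∩ H¹₀(Ω)`, with the `H¹` norm; an element is a pair `(u, ∇u)`. -/
def V : Submodule ℝ D.L2Pair :=
  D.H10 ⊓ D.H.comap (WithLp.fstL 2 ℝ D.L2 D.L2Vec : D.L2Pair →ₗ[ℝ] D.L2)

/-- The function `u ∈ L²(Ω)` underlying an element of `𝓥`. -/
def toFun (w : D.V) : D.L2 := (w : D.L2Pair).fst

/-- The gradient `∇u ∈ L²(Ω; ℝ^N)` of an element of `𝓥`. -/
def grad (w : D.V) : D.L2Vec := (w : D.L2Pair).snd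

/-- The element `L_u ∈ 𝓥'` defined by `u ∈ 𝓗`: `L_u(w) = ∫_Ω u w`. -/
def toDual (u : D.H) : StrongDual ℝ D.V :=
  (innerSL ℝ (u : D.L2)).comp ((WithLp.fstL 2 ℝ D.L2 D.L2Vec).comp D.V.subtypeL)

/-- The bilinear form `(u, w) ↦ ∫_A ∇w(x) · M(x) ∇u(x) dx`. -/
def form (M : EuclideanSpace ℝ (Fin N) → Matrix (Fin N) (Fin N) ℝ) (u w : D.V) : ℝ :=
  ∫ x in D.A, inner ℝ (D.grad w x) (Matrix.toEuclideanLin (M x) (D.grad u x))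

/-- `r` is the function `ρ`, viewed as an element of `L²(ℝ₊; 𝓥)`. -/
def IsL2Lift (ρ : ℝ≥0 →ᵇ D.H) (r : ℝ → D.V) : Prop :=
  MemLp r 2 (volume.restrict (Ioi 0)) ∧
    ∀ᵐ t ∂(volume.restrict (Ioi (0 : ℝ))), D.toFun (r t) = (ρ t.toNNReal : D.L2)

/-- `σ` is the derivative `∂_t ρ` in the sense of `𝓥'`-valued distributions on `(0, ∞)`, and it
belongs to `L²(ℝ₊; 𝓥')`. -/
def IsL2TimeDeriv (ρ : ℝ≥0 →ᵇ D.H) (σ : ℝ → StrongDual ℝ D.V) : Prop :=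
  MemLp σ 2 (volume.restrict (Ioi 0)) ∧
    ∀ φ : 𝓓((⟨Ioi 0, isOpen_Ioi⟩ : Opens ℝ), ℝ),
      ∫ t in Ioi (0 : ℝ), deriv φ t • D.toDual (ρ t.toNNReal) = - ∫ t in Ioi (0 : ℝ), φ t • σ t

/-- Weak solutions of the limit diffusion problem with diffusion matrix `M` and initial datum
`ρin ∈ 𝓗`: functions `ρ ∈ C_b(ℝ₊; 𝓗) ∩ L²(ℝ₊; 𝓥)` with `∂_t ρ ∈ L²(ℝ₊; 𝓥')`, `ρ(0) = ρin` and,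
for all `w ∈ 𝓥`, `d/dt ∫_Ω ρ(t, x) w(x) dx + ∫_A ∇w · M ∇ρ(t) dx = 0` for a.e. `t ≥ 0`. -/
def IsWeakSolution (M : EuclideanSpace ℝ (Fin N) → Matrix (Fin N) (Fin N) ℝ) (ρin : D.H)
    (ρ : ℝ≥0 →ᵇ D.H) : Prop :=
  (∃ σ : ℝ → StrongDual ℝ D.V, D.IsL2TimeDeriv ρ σ) ∧ ρ 0 = ρin ∧
    ∃ r : ℝ → D.V, D.IsL2Lift ρ r ∧
      ∀ w : D.V, ∀ᵐ t ∂(volume.restrict (Ioi (0 : ℝ))),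
        HasDerivAt
          (fun s : ℝ => ∫ x in (D.Ω : Set (EuclideanSpace ℝ (Fin N))),
            (ρ s.toNNReal : D.L2) x * D.toFun w x)
          (- D.form M (r t) w) t

end DiffusionDomain

end

/-! The problem is an abstract evolution equation: `j : V → H` is the inclusion, `a` is the form
built from `M`, and one wants `⟪ρ, j w⟫' + a(r, w) = 0` with `j r = ρ`. Integrated in time this is
`IsMildSolution`. Three facts about the domain make it well posed: `a` is bounded, `a` is coercive
on all of `𝓥`, and `j` has dense range.

Coercivity is the delicate one, since `a` only sees gradients on `A`. An element of `𝓥` is constant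
on each `B_l`, and the gradient of an `H¹₀` function vanishes a.e. on level sets
(`snd_eq_zero_of_fst_eq`), so no gradient is lost outside `A`, however rough the `B_l` are. The
Poincaré inequality then controls the full norm. For density, test functions supported in `A` force
an orthogonal `u` to vanish on `A`, and cutoffs equal to `1` on a single `B_l` force its mean there
to vanish.

The energy identity carries both uniqueness and the passage to general data. Writing `‖ρ(s+h)‖² -
‖ρ(s)‖²` as `⟪ρ(s+h) - ρ(s), ρ(s+h) + ρ(s)⟫`, one may test the equation with `r(s+h) + r(s)`;
averaging in `s` and letting `h → 0` uses only continuity of translations in `L²`. The form need not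
be symmetric.

For existence, Lax–Milgram gives `T` with `a(T f, w) = ⟪f, j w⟫`, and `S = j ∘ T` is bounded and
monotone. If `(S z)' = -z`, then `ρ = S z`, `r = T z` is a solution. This degenerate equation is
solved by replacing `S⁻¹` with the bounded operators `(S + ε)⁻¹`, as in the Hille–Yosida theorem;
the contraction semigroups they generate converge on data `S² k`. This yields solutions for the
dense set of data `S³ k`, and the energy estimate extends them to all of `H`.

Weak and mild solutions agree: the `L²` distributional derivative makes each `⟪ρ, j w⟫` a primitive,
and the pointwise equation identifies its integrand. -/

noncomputable section

/-! ### Contraction semigroups and the equation `(S z)' = -z` -/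

section DegenerateEvolution

open Filter Topology
open scoped RealInnerProductSpace

variable {H : Type*} [NormedAddCommGroup H] [InnerProductSpace ℝ H]

/-- For a monotone bounded operator `S` and `ε > 0`, the operator `S + ε` is invertible. -/
theorem exists_inverse_add_smul_of_monotone [CompleteSpace H] (S : H →L[ℝ] H)
    (hS : ∀ x, 0 ≤ ⟪S x, x⟫) {ε : ℝ}
    (hε : 0 < ε) :
    ∃ R : H →L[ℝ] H, (∀ x, S (R x) + ε • R x = x) ∧ (∀ x, R (S x) + ε • R x = x) := by
  let T : H →L[ℝ] H := S + ε • ContinuousLinearMap.id ℝ H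
  let b : H →L[ℝ] H →L[ℝ] ℝ := (innerSL ℝ).comp T
  -- Lax–Milgram: monotonicity of `S` makes this form coercive with constant `ε`.
  have hb : IsCoercive b := by
    refine ⟨ε, hε, fun x => ?_⟩
    have : b x x = ⟪S x, x⟫ + ε * (‖x‖ * ‖x‖) := by
      simp only [b, T, ContinuousLinearMap.comp_apply, innerSL_apply_apply,
        add_apply, smul_apply,
        ContinuousLinearMap.id_apply, inner_add_left, real_inner_smul_left,
        real_inner_self_eq_norm_mul_norm]
    rw [this, mul_assoc]
    linarith [hS x]
  let e := hb.continuousLinearEquivOfBilin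
  have he : ∀ x, e x = S x + ε • x := by
    intro x
    refine ext_inner_right ℝ fun y => ?_
    rw [hb.continuousLinearEquivOfBilin_apply]
    change ⟪S x + ε • x, y⟫ = ⟪S x + ε • x, y⟫
    rfl
  refine ⟨e.symm, fun x => ?_, fun x => ?_⟩
  · change S (e.symm x) + ε • e.symm x = x
    rw [← he, e.apply_symm_apply]
  · change e.symm (S x) + ε • e.symm x = x
    rw [← map_smul, ← map_add, ← he, e.symm_apply_apply]

/-- The one-parameter group `exp (-t R)` generated by a bounded operator. -/
def expNeg (R : H →L[ℝ] H) (t : ℝ) : H →L[ℝ] H := NormedSpace.exp (t • (-R))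

theorem expNeg_zero (R : H →L[ℝ] H) : expNeg R 0 = 1 := by
  simp [expNeg]

theorem commute_expNeg {R C : H →L[ℝ] H} (h : Commute C R) (t : ℝ) : Commute C (expNeg R t) := by
  have h1 : Commute C (t • (-R)) := (h.neg_right).smul_right t
  exact h1.exp_right

theorem hasDerivAt_expNeg_apply [CompleteSpace H] (R : H →L[ℝ] H) (x : H) (t : ℝ) :
    HasDerivAt (fun s => expNeg R s x) (-(expNeg R t (R x))) t := by
  have h := (hasDerivAt_exp_smul_const (𝕂 := ℝ) (-R) t).clm_apply (hasDerivAt_const t x)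
  simpa [expNeg] using h

theorem continuous_expNeg_apply [CompleteSpace H] (R : H →L[ℝ] H) (x : H) : Continuous fun s => expNeg R s x :=
  continuous_iff_continuousAt.2 fun t => (hasDerivAt_expNeg_apply R x t).continuousAt

/-- With `y = expNeg R s x`, the derivative of `‖y‖²` is `-2⟪y, R y⟫ ≤ 0`. -/
theorem norm_expNeg_apply_le [CompleteSpace H] {R : H →L[ℝ] H} (hR : ∀ x, 0 ≤ ⟪x, R x⟫) (x : H) {t : ℝ}
    (ht : 0 ≤ t) : ‖expNeg R t x‖ ≤ ‖x‖ := by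
  have hd : ∀ s, HasDerivAt (fun s => ‖expNeg R s x‖ ^ 2)
      (2 * ⟪expNeg R s x, -(expNeg R s (R x))⟫) s :=
    fun s => (hasDerivAt_expNeg_apply R x s).norm_sq
  have hanti : Antitone fun s => ‖expNeg R s x‖ ^ 2 := by
    refine antitone_of_deriv_nonpos (fun s => (hd s).differentiableAt) fun s => ?_
    rw [(hd s).deriv, inner_neg_right]
    have hc : expNeg R s (R x) = R (expNeg R s x) :=
      (congrArg (fun A : H →L[ℝ] H => A x) (commute_expNeg (Commute.refl R) s).eq).symm
    rw [hc]
    linarith [hR (expNeg R s x)]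
  have h := hanti ht
  simp only [expNeg_zero, one_apply_eq_self] at h
  exact (sq_le_sq₀ (norm_nonneg _) (norm_nonneg _)).1 h

/-- Two commuting monotone bounded operators generate nearby contraction semigroups. -/
theorem norm_expNeg_sub_expNeg_le [CompleteSpace H] {R Q : H →L[ℝ] H} (hR : ∀ x, 0 ≤ ⟪x, R x⟫)
    (hQ : ∀ x, 0 ≤ ⟪x, Q x⟫) (hRQ : Commute R Q) (x : H) {t : ℝ} (ht : 0 ≤ t) :
    ‖expNeg R t x - expNeg Q t x‖ ≤ ‖R x - Q x‖ * t := by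
  -- This path joins `expNeg Q t x` to `expNeg R t x`. Commutation turns its velocity into two
  -- contractions applied to `Q x - R x`.
  have hd : ∀ s, HasDerivAt (fun s => expNeg R s (expNeg Q (t - s) x))
      (-(expNeg R s (R (expNeg Q (t - s) x))) + expNeg R s (expNeg Q (t - s) (Q x))) s := by
    intro s
    have h1 := hasDerivAt_exp_smul_const (𝕂 := ℝ) (-R) s
    have h2 : HasDerivAt (fun s => expNeg Q (t - s) x) (expNeg Q (t - s) (Q x)) s := by
      have := (hasDerivAt_expNeg_apply Q x (t - s)).scomp s ((hasDerivAt_id s).const_sub t)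
      simpa [Function.comp_def] using this
    have h3 := h1.clm_apply h2
    simpa [expNeg] using h3
  have hb : ∀ s ∈ Ico (0 : ℝ) t,
      ‖-(expNeg R s (R (expNeg Q (t - s) x))) + expNeg R s (expNeg Q (t - s) (Q x))‖
        ≤ ‖R x - Q x‖ := by
    intro s hs
    have hc : R (expNeg Q (t - s) x) = expNeg Q (t - s) (R x) :=
      congrArg (fun A : H →L[ℝ] H => A x) (commute_expNeg hRQ (t - s)).eq
    have : -(expNeg R s (R (expNeg Q (t - s) x))) + expNeg R s (expNeg Q (t - s) (Q x))
        = expNeg R s (expNeg Q (t - s) (Q x - R x)) := by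
      rw [hc, map_sub, map_sub]; abel
    rw [this, norm_sub_rev (R x)]
    exact (norm_expNeg_apply_le hR _ hs.1).trans
      (norm_expNeg_apply_le hQ _ (sub_nonneg.2 hs.2.le))
  have h := norm_image_sub_le_of_norm_deriv_le_segment'
    (fun s _ => (hd s).hasDerivWithinAt) hb t (right_mem_Icc.2 ht)
  simpa [expNeg_zero] using h

/-- Solvability of the degenerate evolution equation `(S z)' = -z` for a monotone bounded operator
`S` and initial data in the range of `S²`. -/
theorem exists_solution_degenerate_evolution [CompleteSpace H] (S : H →L[ℝ] H) (hS : ∀ x, 0 ≤ ⟪S x, x⟫) (k : H) :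
    ∃ z : ℝ → H, ContinuousOn z (Ici 0) ∧ z 0 = S (S k) ∧
      ∀ t, 0 ≤ t → S (z t) - S (z 0) = -∫ s in (0 : ℝ)..t, z s := by
  let ε : ℕ → ℝ := fun n => 1 / ((n : ℝ) + 1)
  have hε : ∀ n, 0 < ε n := fun n => Nat.one_div_pos_of_nat
  have hε0 : Tendsto ε atTop (𝓝 0) := tendsto_one_div_add_atTop_nhds_zero_nat
  choose R hR1 hR2 using fun n => exists_inverse_add_smul_of_monotone S hS (hε n)
  have hSR : ∀ n, Commute S (R n) := by
    intro n
    ext x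
    have := (hR1 n x).trans (hR2 n x).symm
    exact add_right_cancel this
  have hRmono : ∀ n x, 0 ≤ ⟪x, R n x⟫ := by
    intro n x
    nth_rewrite 1 [← hR1 n x]
    rw [inner_add_left, real_inner_smul_left]
    exact add_nonneg (hS _) (mul_nonneg (hε n).le real_inner_self_nonneg)
  have hRnorm : ∀ n x, ε n * ‖R n x‖ ≤ ‖x‖ := by
    intro n x
    rcases (norm_nonneg (R n x)).eq_or_lt with h0 | h0
    · rw [← h0]; simp
    have h1 : ε n * (‖R n x‖ * ‖R n x‖) ≤ ⟪x, R n x⟫ := by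
      nth_rewrite 3 [← hR1 n x]
      rw [inner_add_left, real_inner_smul_left, real_inner_self_eq_norm_mul_norm]
      linarith [hS (R n x)]
    have h2 := real_inner_le_norm x (R n x)
    have h3 : (ε n * ‖R n x‖) * ‖R n x‖ ≤ ‖x‖ * ‖R n x‖ := by linarith
    exact le_of_mul_le_mul_right h3 h0
  have hRR : ∀ n m, Commute (R n) (R m) := by
    intro n m
    ext x
    have h1 : R n x = R n (R m (S x) + ε m • R m x) := by rw [hR2]
    have hc : ∀ n y, R n (S y) = S (R n y) := fun n y =>
      (congrArg (fun A : H →L[ℝ] H => A y) (hSR n).eq).symm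
    change R n (R m x) = R m (R n x)
    have h2 : R n (R m x) = R m (S (R n (R m x)) + ε m • R n (R m x)) := by
      rw [map_add, map_smul, hR2]
    rw [h2, ← hc, ← map_smul (R n), ← map_add (R n), hR1]
  -- `R n` is only bounded by `1 / ε n`, but on the range of `S` it is bounded uniformly in `n`.
  have hRS : ∀ n y, R n (S y) = y - ε n • R n y := fun n y => eq_sub_of_add_eq (hR2 n y)
  have hRS' : ∀ n y, ‖R n (S y)‖ ≤ 2 * ‖y‖ := by
    intro n y
    rw [hRS]
    refine (norm_sub_le _ _).trans ?_
    rw [norm_smul, Real.norm_of_nonneg (hε n).le]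
    linarith [hRnorm n y]
  -- The square of `S` is needed here: one factor cancels `R n` up to the error `ε n • R n (S k)`,
  -- and the other keeps `R n (S k)` bounded, so the error is of order `ε n`.
  have hdiff : ∀ n m, ‖R n (S (S k)) - R m (S (S k))‖ ≤ 2 * ‖k‖ * (ε n + ε m) := by
    intro n m
    rw [hRS n (S k), hRS m (S k)]
    have : S k - ε n • R n (S k) - (S k - ε m • R m (S k))
        = ε m • R m (S k) - ε n • R n (S k) := by abel
    rw [this]
    refine (norm_sub_le _ _).trans ?_
    rw [norm_smul, norm_smul, Real.norm_of_nonneg (hε n).le, Real.norm_of_nonneg (hε m).le]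
    have h1 := mul_le_mul_of_nonneg_left (hRS' n k) (hε n).le
    have h2 := mul_le_mul_of_nonneg_left (hRS' m k) (hε m).le
    linarith
  let Z : ℕ → ℝ → H := fun n t => expNeg (R n) t (S (S k))
  have hZcauchy : ∀ t, 0 ≤ t → ∀ n m, ‖Z n t - Z m t‖ ≤ 2 * ‖k‖ * (ε n + ε m) * t :=
    fun t ht n m => (norm_expNeg_sub_expNeg_le (hRmono n) (hRmono m) (hRR n m) _ ht).trans
      (mul_le_mul_of_nonneg_right (hdiff n m) ht)
  have hlim : ∀ t, 0 ≤ t → ∃ y, Tendsto (fun n => Z n t) atTop (𝓝 y) := by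
    intro t ht
    refine cauchySeq_tendsto_of_complete ?_
    rw [cauchySeq_iff_tendsto_dist_atTop_0]
    have hg : Tendsto (fun p : ℕ × ℕ => 2 * ‖k‖ * (ε p.1 + ε p.2) * t) atTop (𝓝 0) := by
      have h1 : Tendsto (fun p : ℕ × ℕ => ε p.1) atTop (𝓝 0) := by
        rw [← prod_atTop_atTop_eq]; exact hε0.comp tendsto_fst
      have h2 : Tendsto (fun p : ℕ × ℕ => ε p.2) atTop (𝓝 0) := by
        rw [← prod_atTop_atTop_eq]; exact hε0.comp tendsto_snd
      simpa using ((h1.add h2).const_mul (2 * ‖k‖)).mul_const t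
    refine squeeze_zero (fun _ => dist_nonneg) (fun p => ?_) hg
    rw [dist_eq_norm]
    exact hZcauchy t ht p.1 p.2
  choose! z hz using hlim
  have hZlip : ∀ n s t, 0 ≤ s → s ≤ t → ‖Z n t - Z n s‖ ≤ 2 * ‖S k‖ * (t - s) := by
    intro n s t hs hst
    refine norm_image_sub_le_of_norm_deriv_le_segment'
      (f := Z n) (fun r _ => (hasDerivAt_expNeg_apply (R n) _ r).hasDerivWithinAt)
      (fun r hr => ?_) t (right_mem_Icc.2 hst)
    rw [norm_neg]
    exact (norm_expNeg_apply_le (hRmono n) _ (hs.trans hr.1)).trans (hRS' n _)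
  have hzlip : ∀ s t, 0 ≤ s → s ≤ t → ‖z t - z s‖ ≤ 2 * ‖S k‖ * (t - s) := fun s t hs hst =>
    le_of_tendsto (((hz t (hs.trans hst)).sub (hz s hs)).norm)
      (Eventually.of_forall fun n => hZlip n s t hs hst)
  have hzcont : ContinuousOn z (Ici 0) := by
    refine (LipschitzOnWith.of_dist_le_mul (K := (2 * ‖S k‖).toNNReal) ?_).continuousOn
    intro s hs t ht
    rw [Real.coe_toNNReal _ (by positivity), dist_eq_norm, dist_eq_norm, Real.norm_eq_abs]
    rcases le_total s t with h | h
    · rw [norm_sub_rev, abs_sub_comm, abs_of_nonneg (sub_nonneg.2 h)]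
      exact hzlip s t hs h
    · rw [abs_of_nonneg (sub_nonneg.2 h)]
      exact hzlip t s ht h
  have hz0 : z 0 = S (S k) := by
    refine tendsto_nhds_unique (hz 0 le_rfl) ?_
    simp only [Z, expNeg_zero, one_apply_eq_self]
    exact tendsto_const_nhds
  refine ⟨z, hzcont, hz0, fun t ht => ?_⟩
  have hint : Tendsto (fun n => ∫ s in (0 : ℝ)..t, Z n s) atTop (𝓝 (∫ s in (0 : ℝ)..t, z s)) := by
    refine intervalIntegral.tendsto_integral_filter_of_dominated_convergence
      (fun _ => ‖S (S k)‖) (Eventually.of_forall fun n =>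
        (continuous_expNeg_apply (R n) _).aestronglyMeasurable)
      (Eventually.of_forall fun n => Eventually.of_forall fun s hs => ?_)
      intervalIntegrable_const (Eventually.of_forall fun s hs => ?_)
    · rw [uIoc_of_le ht] at hs
      exact norm_expNeg_apply_le (hRmono n) _ hs.1.le
    · rw [uIoc_of_le ht] at hs
      exact hz s hs.1.le
  have hcomm : ∀ n s y, S (expNeg (R n) s y) = expNeg (R n) s (S y) := fun n s y =>
    congrArg (fun A : H →L[ℝ] H => A y) (commute_expNeg (hSR n) s).eq
  -- Since `S (R n) = 1 - ε n R n`, the approximation solves the limit equation up to a defect whose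
  -- time derivative is of order `ε n`.
  have happrox : ∀ n, ‖S (Z n t) - S (Z n 0) + ∫ s in (0 : ℝ)..t, Z n s‖
      ≤ ε n * (2 * ‖S k‖) * t := by
    intro n
    have hd : ∀ s, HasDerivAt (fun s => S (Z n s) + ∫ r in (0 : ℝ)..s, Z n r)
        (ε n • expNeg (R n) s (R n (S (S k)))) s := by
      intro s
      have h1 := S.hasFDerivAt.comp_hasDerivAt s (hasDerivAt_expNeg_apply (R n) (S (S k)) s)
      have h2 := ((continuous_expNeg_apply (R n) (S (S k))).integral_hasStrictDerivAt
        0 s).hasDerivAt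
      refine (h1.add h2).congr_deriv ?_
      rw [map_neg, hcomm, ← map_smul]
      have hc : S (R n (S (S k))) = S (S k) - ε n • R n (S (S k)) :=
        eq_sub_of_add_eq (hR1 n _)
      rw [hc, map_sub]
      abel
    have h := norm_image_sub_le_of_norm_deriv_le_segment' (C := ε n * (2 * ‖S k‖))
      (fun s _ => (hd s).hasDerivWithinAt)
      (fun s hs => by
        rw [norm_smul, Real.norm_of_nonneg (hε n).le]
        exact mul_le_mul_of_nonneg_left
          ((norm_expNeg_apply_le (hRmono n) _ hs.1).trans (hRS' n _)) (hε n).le)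
      t (right_mem_Icc.2 ht)
    simp only [intervalIntegral.integral_same, add_zero, sub_zero] at h
    rwa [sub_add_eq_add_sub]
  have hL : Tendsto (fun n => S (Z n t) - S (Z n 0) + ∫ s in (0 : ℝ)..t, Z n s) atTop
      (𝓝 (S (z t) - S (z 0) + ∫ s in (0 : ℝ)..t, z s)) :=
    (((S.continuous.tendsto _).comp (hz t ht)).sub
      ((S.continuous.tendsto _).comp (hz 0 le_rfl))).add hint
  have h0 : Tendsto (fun n => S (Z n t) - S (Z n 0) + ∫ s in (0 : ℝ)..t, Z n s) atTop (𝓝 0) := by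
    refine squeeze_zero_norm happrox ?_
    simpa using (hε0.mul_const (2 * ‖S k‖)).mul_const t
  exact eq_neg_of_add_eq_zero_left (tendsto_nhds_unique hL h0)

end DegenerateEvolution

/-! ### Mild solutions and the energy identity -/

section EnergyIdentity

open Filter Topology
open scoped RealInnerProductSpace

variable {V H : Type*} [NormedAddCommGroup V] [NormedSpace ℝ V]
  [NormedAddCommGroup H] [InnerProductSpace ℝ H]

/-- Bilinear pairings of translates of a square integrable function depend continuously on the
translations. -/
theorem continuous_integral_bilin_translate (a : V →L[ℝ] V →L[ℝ] ℝ) {R : ℝ → V}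
    (hR : MemLp R 2) (s : Set ℝ) :
    Continuous fun p : ℝ × ℝ => ∫ x in s, a (R (x + p.1)) (R (x + p.2) + R x) := by
  have hmp : ∀ θ : ℝ, MeasurePreserving (fun x : ℝ => x + θ) volume volume :=
    fun θ => measurePreserving_add_right volume θ
  let g : C(ℝ, C(ℝ, ℝ)) := (ContinuousMap.mk (fun q : ℝ × ℝ => q.2 + q.1) (by fun_prop)).curry
  let τ : ℝ → Lp V 2 (volume : Measure ℝ) :=
    fun θ => Lp.compMeasurePreserving (g θ) (hmp θ) (hR.toLp R)
  have hτ : Continuous τ :=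
    Continuous.compMeasurePreservingLp continuous_const g.continuous hmp (by norm_num)
  let ρ := LpToLpRestrictCLM ℝ V ℝ volume 2 s
  have hc : Continuous fun p : ℝ × ℝ =>
      a.lpPairing (volume.restrict s) 2 2 (ρ (τ p.1)) (ρ (τ p.2 + hR.toLp R)) := by
    have h1 : Continuous fun p : ℝ × ℝ => ρ (τ p.1) := by fun_prop
    have h2 : Continuous fun p : ℝ × ℝ => ρ (τ p.2 + hR.toLp R) := by fun_prop
    exact ((a.lpPairing (volume.restrict s) 2 2).continuous.comp h1).clm_apply h2
  refine hc.congr fun p => ?_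
  rw [ContinuousLinearMap.lpPairing_eq_integral]
  have hval : ∀ θ, (τ θ : ℝ → V) =ᵐ[volume] fun x => R (x + θ) := fun θ =>
    (Lp.coeFn_compMeasurePreserving _ (hmp θ)).trans
      ((hmp θ).quasiMeasurePreserving.ae_eq_comp hR.coeFn_toLp)
  refine integral_congr_ae ?_
  filter_upwards [LpToLpRestrictCLM_coeFn ℝ s (τ p.1),
    LpToLpRestrictCLM_coeFn ℝ s (τ p.2 + hR.toLp R), ae_restrict_of_ae (hval p.1),
    ae_restrict_of_ae (hval p.2), ae_restrict_of_ae hR.coeFn_toLp,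
    ae_restrict_of_ae (Lp.coeFn_add (τ p.2) (hR.toLp R))] with x h1 h2 h3 h4 h5 h6
  rw [h1, h2, h3, h6, Pi.add_apply, h4, h5]

/-- The integrand is dominated by `‖a‖ (‖R (s + θ)‖² + ‖K s‖²)`; translation invariance in `s` makes
the first term integrable over a bounded range of `θ`. Strong measurability of `R` gives
measurability of the shifted function in both variables. -/
theorem integrable_bilin_translate (a : V →L[ℝ] V →L[ℝ] ℝ) {R K : ℝ → V}
    (hRm : StronglyMeasurable R) (hKm : StronglyMeasurable K) (hR : MemLp R 2) (hK : MemLp K 2)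
    (t h : ℝ) :
    Integrable (fun p : ℝ × ℝ => a (R (p.1 + p.2)) (K p.1))
      ((volume.restrict (Ioc 0 t)).prod (volume.restrict (Ioc 0 h))) := by
  have hR2 : Integrable (fun x => ‖R x‖ ^ 2) := (memLp_two_iff_integrable_sq_norm hR.1).1 hR
  have hK2 : Integrable (fun x => ‖K x‖ ^ 2) := (memLp_two_iff_integrable_sq_norm hK.1).1 hK
  have hm1 : StronglyMeasurable fun p : ℝ × ℝ => R (p.1 + p.2) :=
    hRm.comp_measurable (measurable_fst.add measurable_snd)
  have hm2 : StronglyMeasurable fun p : ℝ × ℝ => K p.1 := hKm.comp_measurable measurable_fst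
  have i1 : Integrable (fun p : ℝ × ℝ => ‖R (p.1 + p.2)‖ ^ 2)
      ((volume : Measure ℝ).prod (volume.restrict (Ioc 0 h))) := by
    rw [integrable_prod_iff' (f := fun p : ℝ × ℝ => ‖R (p.1 + p.2)‖ ^ 2)
      (hm1.norm.pow 2).aestronglyMeasurable]
    refine ⟨Eventually.of_forall fun y => hR2.comp_add_right y, ?_⟩
    have : ∀ y : ℝ, ∫ x, ‖‖R (x + y)‖ ^ 2‖ = ∫ x, ‖‖R x‖ ^ 2‖ := fun y =>
      integral_add_right_eq_self (μ := volume) (fun x => ‖‖R x‖ ^ 2‖) y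
    simp only [this]
    exact integrable_const _
  have i2 : Integrable (fun p : ℝ × ℝ => ‖K p.1‖ ^ 2)
      ((volume : Measure ℝ).prod (volume.restrict (Ioc 0 h))) := hK2.comp_fst _
  have hle : (volume.restrict (Ioc 0 t)).prod (volume.restrict (Ioc 0 h))
      ≤ (volume : Measure ℝ).prod (volume.restrict (Ioc 0 h)) :=
    Measure.prod_mono Measure.restrict_le_self le_rfl
  refine ((i1.add i2).const_mul ‖a‖).mono_measure hle |>.mono' ?_ ?_
  · exact a.aestronglyMeasurable_comp₂ hm1.aestronglyMeasurable hm2.aestronglyMeasurable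
  · refine Eventually.of_forall fun p => (a.le_opNorm₂ _ _).trans ?_
    simp only [Pi.add_apply]
    rw [mul_assoc]
    refine mul_le_mul_of_nonneg_left ?_ (by positivity)
    nlinarith [sq_nonneg (‖R (p.1 + p.2)‖ - ‖K p.1‖), sq_nonneg (‖R (p.1 + p.2)‖ + ‖K p.1‖)]

/-- Fubini and the substitution `θ = h x` turn the average into `∫₀¹ Φ(h x, h) dx`, where `Φ` is
continuous because translations are continuous in `L²`. The factor `2` is `R s + R s` at `h = 0`. -/
theorem tendsto_average_bilin_translate (a : V →L[ℝ] V →L[ℝ] ℝ) {R : ℝ → V}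
    (hRm : StronglyMeasurable R) (hR : MemLp R 2) (t : ℝ) :
    Tendsto (fun h : ℝ => h⁻¹ * ∫ s in Ioc 0 t, ∫ θ in Ioc 0 h, a (R (s + θ)) (R (s + h) + R s))
      (𝓝[>] 0) (𝓝 (2 * ∫ s in Ioc 0 t, a (R s) (R s))) := by
  let Φ : ℝ × ℝ → ℝ := fun p => ∫ x in Ioc 0 t, a (R (x + p.1)) (R (x + p.2) + R x)
  have hΦ : Continuous Φ := continuous_integral_bilin_translate a hR _
  have hc : Continuous fun h : ℝ => ∫ x in (0 : ℝ)..1, Φ (h * x, h) :=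
    intervalIntegral.continuous_parametric_intervalIntegral_of_continuous'
      (f := fun h x => Φ (h * x, h)) (by fun_prop) 0 1
  have h0 : ∫ x in (0 : ℝ)..1, Φ ((0 : ℝ) * x, 0) = 2 * ∫ s in Ioc 0 t, a (R s) (R s) := by
    simp only [zero_mul, intervalIntegral.integral_const, sub_zero, one_smul, Φ, add_zero, map_add]
    rw [← integral_const_mul]
    exact integral_congr_ae (Eventually.of_forall fun s => (two_mul _).symm)
  rw [← h0]
  refine ((hc.tendsto 0).mono_left nhdsWithin_le_nhds).congr' ?_
  filter_upwards [self_mem_nhdsWithin] with h hh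
  have hh : 0 < h := hh
  have hcv := intervalIntegral.integral_comp_mul_left (a := 0) (b := 1)
    (fun θ => Φ (θ, h)) hh.ne'
  rw [hcv, mul_zero, mul_one, smul_eq_mul, intervalIntegral.integral_of_le hh.le]
  congr 1
  have hRh : MemLp (fun s => R (s + h)) 2 :=
    hR.comp_measurePreserving (measurePreserving_add_right volume h)
  have hm : StronglyMeasurable fun s => R (s + h) + R s :=
    (hRm.comp_measurable (measurable_add_const h)).add hRm
  exact (integral_integral_swap (f := fun s θ => a (R (s + θ)) (R (s + h) + R s))
    (integrable_bilin_translate a hRm hm hR (hRh.add hR) t h)).symm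

/-- The integrals over the common interval cancel, leaving the average of `f` on `[t, t + h]` minus
its average on `[0, h]`. -/
theorem tendsto_average_increment {f : ℝ → ℝ} (hf : Continuous f) (t : ℝ) :
    Tendsto (fun h : ℝ => h⁻¹ * ∫ s in (0 : ℝ)..t, (f (s + h) - f s)) (𝓝[>] 0)
      (𝓝 (f t - f 0)) := by
  have hd : ∀ x, Tendsto (fun h : ℝ => h⁻¹ * ∫ s in x..(x + h), f s) (𝓝[>] 0) (𝓝 (f x)) := by
    intro x
    have h1 := hasDerivAt_iff_tendsto_slope_zero.1
      (hf.integral_hasStrictDerivAt x x).hasDerivAt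
    refine (h1.mono_left (nhdsGT_le_nhdsNE 0)).congr fun h => ?_
    simp
  refine ((hd t).sub (hd 0)).congr fun h => ?_
  have hi : ∀ x y, IntervalIntegrable f volume x y := fun x y => hf.intervalIntegrable x y
  have hih : IntervalIntegrable (fun s => f (s + h)) volume 0 t :=
    (hf.comp (continuous_add_const h)).intervalIntegrable _ _
  rw [← mul_sub, intervalIntegral.integral_sub hih (hi _ _),
    intervalIntegral.integral_comp_add_right (fun s => f s) h]
  have e1 := intervalIntegral.integral_add_adjacent_intervals (hi 0 (0 + h)) (hi (0 + h) (t + h))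
  have e2 := intervalIntegral.integral_add_adjacent_intervals (hi 0 t) (hi t (t + h))
  congr 1
  linarith

/-- Solutions of the abstract evolution problem `⟪ρ, j w⟫' + a (r, w) = 0`, `j r = ρ`, in
integrated form. -/
structure IsMildSolution (j : V →L[ℝ] H) (a : V →L[ℝ] V →L[ℝ] ℝ) (ρ : ℝ → H) (r : ℝ → V) :
    Prop where
  continuousOn : ContinuousOn ρ (Ici 0)
  memLp : ∀ T, MemLp r 2 (volume.restrict (Ioc 0 T))
  lift : ∀ᵐ t ∂(volume.restrict (Ioi (0 : ℝ))), j (r t) = ρ t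
  eqn : ∀ w t, 0 ≤ t → ⟪ρ t, j w⟫ - ⟪ρ 0, j w⟫ = -∫ s in (0 : ℝ)..t, a (r s) w

namespace IsMildSolution

variable {j : V →L[ℝ] H} {a : V →L[ℝ] V →L[ℝ] ℝ} {ρ ρ' : ℝ → H} {r r' : ℝ → V}

theorem integrableOn_apply (h : IsMildSolution j a ρ r) (w : V) (T : ℝ) :
    IntegrableOn (fun s => a (r s) w) (Ioc 0 T) :=
  ((a.flip w).comp_memLp' (h.memLp T)).integrable (by norm_num)

theorem integrableOn_self (h : IsMildSolution j a ρ r) (T : ℝ) :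
    IntegrableOn (fun s => a (r s) (r s)) (Ioc 0 T) := by
  have h2 := (memLp_two_iff_integrable_sq_norm (h.memLp T).1).1 (h.memLp T)
  refine (h2.const_mul ‖a‖).mono'
    (a.aestronglyMeasurable_comp₂ (h.memLp T).1 (h.memLp T).1)
    (Eventually.of_forall fun s => ?_)
  rw [sq, ← mul_assoc]
  exact a.le_opNorm₂ _ _

theorem sub (h : IsMildSolution j a ρ r) (h' : IsMildSolution j a ρ' r') :
    IsMildSolution j a (fun t => ρ t - ρ' t) (fun t => r t - r' t) where
  continuousOn := h.continuousOn.sub h'.continuousOn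
  memLp T := (h.memLp T).sub (h'.memLp T)
  lift := by
    filter_upwards [h.lift, h'.lift] with t h1 h2
    rw [map_sub, h1, h2]
  eqn w t ht := by
    have e1 := h.eqn w t ht
    have e2 := h'.eqn w t ht
    simp only [inner_sub_left, map_sub, sub_apply]
    rw [intervalIntegral.integral_sub]
    · linarith
    · exact (intervalIntegrable_iff_integrableOn_Ioc_of_le ht).2 (h.integrableOn_apply w t)
    · exact (intervalIntegrable_iff_integrableOn_Ioc_of_le ht).2 (h'.integrableOn_apply w t)

theorem increment (h : IsMildSolution j a ρ r) (w : V) {s t : ℝ} (hs : 0 ≤ s) (hst : s ≤ t) :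
    ⟪ρ t - ρ s, j w⟫ = -∫ x in s..t, a (r x) w := by
  have e1 := h.eqn w t (hs.trans hst)
  have e2 := h.eqn w s hs
  have i1 : IntervalIntegrable (fun x => a (r x) w) volume 0 s :=
    (intervalIntegrable_iff_integrableOn_Ioc_of_le hs).2 (h.integrableOn_apply w s)
  have i2 : IntervalIntegrable (fun x => a (r x) w) volume s t :=
    (intervalIntegrable_iff_integrableOn_Ioc_of_le hst).2
      ((h.integrableOn_apply w t).mono_set (Ioc_subset_Ioc_left hs))
  have e3 := intervalIntegral.integral_add_adjacent_intervals i1 i2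
  rw [inner_sub_left]
  linarith

/-- The energy identity. -/
theorem energy (h : IsMildSolution j a ρ r) {t : ℝ} (ht : 0 ≤ t) :
    ‖ρ t‖ ^ 2 + 2 * ∫ s in (0 : ℝ)..t, a (r s) (r s) = ‖ρ 0‖ ^ 2 := by
  -- a globally defined, strongly measurable version of `r` on `(0, t + 1]`
  have hrm := (h.memLp (t + 1)).1
  let R : ℝ → V := (Ioc 0 (t + 1)).indicator (hrm.mk r)
  have hRm : StronglyMeasurable R := hrm.stronglyMeasurable_mk.indicator measurableSet_Ioc
  have hR : MemLp R 2 :=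
    (memLp_indicator_iff_restrict measurableSet_Ioc).2 ((h.memLp (t + 1)).ae_eq hrm.ae_eq_mk)
  have hRr : ∀ᵐ s, s ∈ Ioc 0 (t + 1) → R s = r s := by
    rw [← ae_restrict_iff' measurableSet_Ioc]
    filter_upwards [hrm.ae_eq_mk, ae_restrict_mem measurableSet_Ioc] with s h1 h2
    rw [h1]; exact indicator_of_mem h2 _
  have hlift : ∀ᵐ s, s ∈ Ioi (0 : ℝ) → j (r s) = ρ s :=
    (ae_restrict_iff' measurableSet_Ioi).1 h.lift
  -- `ρ` is continuous only on the half-line; `max s 0` extends it by its initial value.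
  have hfc : Continuous fun s : ℝ => ‖ρ (max s 0)‖ ^ 2 :=
    (h.continuousOn.comp_continuous (continuous_id.max continuous_const)
      fun s => le_max_right s 0).norm.pow 2
  have hL := tendsto_average_increment hfc t
  have hRlim := (tendsto_average_bilin_translate a hRm hR t).neg
  have heq : (fun h : ℝ => h⁻¹ * ∫ s in (0 : ℝ)..t,
        (‖ρ (max (s + h) 0)‖ ^ 2 - ‖ρ (max s 0)‖ ^ 2)) =ᶠ[𝓝[>] 0]
      fun h => -(h⁻¹ * ∫ s in Ioc 0 t, ∫ θ in Ioc 0 h, a (R (s + θ)) (R (s + h) + R s)) := by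
    -- The bound `δ ≤ 1` keeps all shifted times in `(0, t + 1]`, where `R` agrees with `r` almost
    -- everywhere.
    filter_upwards [Ioc_mem_nhdsGT (zero_lt_one' ℝ)] with δ hδ
    rw [← mul_neg, intervalIntegral.integral_of_le ht, ← integral_neg]
    congr 1
    refine setIntegral_congr_ae measurableSet_Ioc ?_
    have hsh : ∀ᵐ s, s + δ ∈ Ioc 0 (t + 1) → R (s + δ) = r (s + δ) :=
      (measurePreserving_add_right volume δ).quasiMeasurePreserving.ae hRr
    have hsl : ∀ᵐ s, s + δ ∈ Ioi (0 : ℝ) → j (r (s + δ)) = ρ (s + δ) :=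
      (measurePreserving_add_right volume δ).quasiMeasurePreserving.ae hlift
    filter_upwards [hRr, hlift, hsh, hsl] with s h1 h2 h3 h4 hs
    have m1 : s ∈ Ioc 0 (t + 1) := ⟨hs.1, by linarith [hs.2]⟩
    have m2 : s + δ ∈ Ioc 0 (t + 1) := ⟨by linarith [hs.1, hδ.1], by linarith [hs.2, hδ.2]⟩
    rw [max_eq_left hs.1.le, max_eq_left m2.1.le, h1 m1, h3 m2]
    have hsum : j (r (s + δ) + r s) = ρ (s + δ) + ρ s := by
      rw [map_add, h2 hs.1, h4 m2.1]
    -- With `s` frozen, `r (s + δ) + r s` is an admissible test vector whose image under `j` is `ρ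
    -- (s + δ) + ρ s`.
    have hinc := h.increment (r (s + δ) + r s) hs.1.le (by linarith [hδ.1] : s ≤ s + δ)
    rw [hsum] at hinc
    have hsq : ‖ρ (s + δ)‖ ^ 2 - ‖ρ s‖ ^ 2 = ⟪ρ (s + δ) - ρ s, ρ (s + δ) + ρ s⟫ := by
      rw [inner_sub_left, inner_add_right, inner_add_right, real_inner_self_eq_norm_sq,
        real_inner_self_eq_norm_sq, real_inner_comm (ρ s) (ρ (s + δ))]
      ring
    rw [hsq, hinc]
    congr 1
    have hcv := intervalIntegral.integral_comp_add_left (a := 0) (b := δ)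
      (fun x => a (r x) (r (s + δ) + r s)) s
    rw [add_zero] at hcv
    rw [← hcv, intervalIntegral.integral_of_le hδ.1.le]
    refine setIntegral_congr_ae measurableSet_Ioc ?_
    have hθ : ∀ᵐ θ, s + θ ∈ Ioc 0 (t + 1) → R (s + θ) = r (s + θ) :=
      (measurePreserving_add_left volume s).quasiMeasurePreserving.ae hRr
    filter_upwards [hθ] with θ hθ' hmem
    rw [hθ' ⟨by linarith [hs.1, hmem.1], by linarith [hs.2, hmem.2, hδ.2]⟩]
  have hfin := tendsto_nhds_unique (hL.congr' heq) hRlim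
  have hint : ∫ s in Ioc 0 t, a (R s) (R s) = ∫ s in (0 : ℝ)..t, a (r s) (r s) := by
    rw [intervalIntegral.integral_of_le ht]
    refine setIntegral_congr_ae measurableSet_Ioc ?_
    filter_upwards [hRr] with s h1 hs
    rw [h1 ⟨hs.1, by linarith [hs.2]⟩]
  rw [hint, max_eq_left ht, max_self] at hfin
  linarith

end IsMildSolution

end EnergyIdentity

/-! ### Energy estimates and existence for all initial data -/

section AbstractExistence

open Filter Topology
open scoped RealInnerProductSpace

variable {V H : Type*} [NormedAddCommGroup V] [InnerProductSpace ℝ V]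
  [NormedAddCommGroup H] [InnerProductSpace ℝ H]

namespace IsMildSolution

variable {j : V →L[ℝ] H} {a : V →L[ℝ] V →L[ℝ] ℝ} {ρ ρ' : ℝ → H} {r r' : ℝ → V}

theorem congr (h : IsMildSolution j a ρ r) (hρ : ∀ t, 0 ≤ t → ρ t = ρ' t)
    (hr : ∀ᵐ t ∂(volume.restrict (Ioi (0 : ℝ))), r t = r' t) : IsMildSolution j a ρ' r' where
  continuousOn := h.continuousOn.congr fun t ht => (hρ t ht).symm
  memLp T := (h.memLp T).ae_eq (ae_mono (Measure.restrict_mono Ioc_subset_Ioi_self le_rfl) hr)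
  lift := by
    filter_upwards [h.lift, hr, ae_restrict_mem measurableSet_Ioi] with t h1 h2 ht
    rw [← h2, h1, hρ t (le_of_lt ht)]
  eqn w t ht := by
    rw [← hρ t ht, ← hρ 0 le_rfl, h.eqn w t ht, intervalIntegral.integral_of_le ht,
      intervalIntegral.integral_of_le ht]
    congr 1
    refine integral_congr_ae ?_
    filter_upwards [ae_mono (Measure.restrict_mono Ioc_subset_Ioi_self le_rfl) hr] with s hs
    rw [hs]

theorem norm_sq_add_integral_le (h : IsMildSolution j a ρ r) {C : ℝ}
    (hC : ∀ v, C * ‖v‖ * ‖v‖ ≤ a v v) {t : ℝ} (ht : 0 ≤ t) :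
    ‖ρ t‖ ^ 2 + 2 * C * ∫ s in (0 : ℝ)..t, ‖r s‖ ^ 2 ≤ ‖ρ 0‖ ^ 2 := by
  rw [← h.energy ht, mul_assoc, ← intervalIntegral.integral_const_mul]
  have h2 := (memLp_two_iff_integrable_sq_norm (h.memLp t).1).1 (h.memLp t)
  gcongr ‖ρ t‖ ^ 2 + 2 * ?_
  refine intervalIntegral.integral_mono_on ht ?_ ?_ fun s _ => ?_
  · exact (intervalIntegrable_iff_integrableOn_Ioc_of_le ht).2 (h2.const_mul C)
  · exact (intervalIntegrable_iff_integrableOn_Ioc_of_le ht).2 (h.integrableOn_self t)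
  · rw [sq, ← mul_assoc]; exact hC _

theorem norm_le (h : IsMildSolution j a ρ r) (ha : IsCoercive a) {t : ℝ} (ht : 0 ≤ t) :
    ‖ρ t‖ ≤ ‖ρ 0‖ := by
  obtain ⟨C, hC0, hC⟩ := ha
  have h1 := h.norm_sq_add_integral_le hC ht
  have h2 : 0 ≤ ∫ s in (0 : ℝ)..t, ‖r s‖ ^ 2 :=
    intervalIntegral.integral_nonneg ht fun s _ => sq_nonneg _
  refine (sq_le_sq₀ (norm_nonneg _) (norm_nonneg _)).1 ?_
  nlinarith [mul_nonneg hC0.le h2]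

theorem aestronglyMeasurable (h : IsMildSolution j a ρ r) :
    AEStronglyMeasurable r (volume.restrict (Ioi 0)) := by
  have : Ioi (0 : ℝ) = ⋃ n : ℕ, Ioc (0 : ℝ) n := by
    ext t
    simp only [mem_Ioi, mem_iUnion, mem_Ioc, exists_and_left, iff_self_and]
    exact fun _ => exists_nat_ge t
  rw [this, aestronglyMeasurable_iUnion_iff]
  exact fun n => (h.memLp n).1

theorem integrableOn_norm_sq_and_integral_le (h : IsMildSolution j a ρ r) {C : ℝ} (hC0 : 0 < C)
    (hC : ∀ v, C * ‖v‖ * ‖v‖ ≤ a v v) :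
    IntegrableOn (fun s => ‖r s‖ ^ 2) (Ioi 0) ∧
      2 * C * ∫ s in Ioi (0 : ℝ), ‖r s‖ ^ 2 ≤ ‖ρ 0‖ ^ 2 := by
  have hb : ∀ t, 0 ≤ t → 2 * C * ∫ s in (0 : ℝ)..t, ‖r s‖ ^ 2 ≤ ‖ρ 0‖ ^ 2 := fun t ht => by
    linarith [h.norm_sq_add_integral_le hC ht, sq_nonneg ‖ρ t‖]
  have hint : IntegrableOn (fun s => ‖r s‖ ^ 2) (Ioi 0) := by
    refine integrableOn_Ioi_of_intervalIntegral_norm_bounded (‖ρ 0‖ ^ 2 / (2 * C)) 0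
      (b := fun t : ℝ => t) (l := atTop)
      (fun t => (memLp_two_iff_integrable_sq_norm (h.memLp t).1).1 (h.memLp t)) tendsto_id ?_
    filter_upwards [eventually_ge_atTop 0] with t ht
    rw [le_div_iff₀ (by positivity), mul_comm]
    simpa using hb t ht
  refine ⟨hint, ?_⟩
  have hlim := (intervalIntegral_tendsto_integral_Ioi 0 hint tendsto_id).const_mul (2 * C)
  refine le_of_tendsto hlim ?_
  filter_upwards [eventually_ge_atTop 0] with t ht using hb t ht

theorem memLp_Ioi (h : IsMildSolution j a ρ r) (ha : IsCoercive a) :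
    MemLp r 2 (volume.restrict (Ioi 0)) := by
  obtain ⟨C, hC0, hC⟩ := ha
  exact (memLp_two_iff_integrable_sq_norm h.aestronglyMeasurable).2
    (h.integrableOn_norm_sq_and_integral_le hC0 hC).1

theorem exists_boundedContinuousFunction (h : IsMildSolution j a ρ r) (ha : IsCoercive a) :
    ∃ P : ℝ≥0 →ᵇ H, P 0 = ρ 0 ∧ IsMildSolution j a (fun t => P t.toNNReal) r := by
  have hc : Continuous fun t : ℝ≥0 => ρ t :=
    h.continuousOn.comp_continuous NNReal.continuous_coe fun t => t.2
  refine ⟨BoundedContinuousFunction.ofNormedAddCommGroup _ hc ‖ρ 0‖ fun t => h.norm_le ha t.2,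
    rfl, h.congr (fun t ht => ?_) (Eventually.of_forall fun _ => rfl)⟩
  simp [Real.coe_toNNReal t ht]

/-- A mild solution is controlled by its initial value. -/
theorem norm_toLp_sq_le (h : IsMildSolution j a ρ r) {C : ℝ} (hC0 : 0 < C)
    (hC : ∀ v, C * ‖v‖ * ‖v‖ ≤ a v v) (hr : MemLp r 2 (volume.restrict (Ioi 0))) :
    2 * C * ‖hr.toLp r‖ ^ 2 ≤ ‖ρ 0‖ ^ 2 := by
  have e : ‖hr.toLp r‖ ^ 2 = ∫ s in Ioi (0 : ℝ), ‖r s‖ ^ 2 := by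
    rw [← real_inner_self_eq_norm_sq, L2.inner_def]
    refine integral_congr_ae ?_
    filter_upwards [hr.coeFn_toLp] with s hs
    rw [hs, real_inner_self_eq_norm_sq]
  rw [e]
  exact (h.integrableOn_norm_sq_and_integral_le hC0 hC).2

/-- Limits of mild solutions are mild solutions. -/
theorem of_tendsto {P : ℕ → ℝ≥0 →ᵇ H} {Q : ℕ → Lp V 2 (volume.restrict (Ioi (0 : ℝ)))}
    {P₀ : ℝ≥0 →ᵇ H} {Q₀ : Lp V 2 (volume.restrict (Ioi (0 : ℝ)))}
    (h : ∀ n, IsMildSolution j a (fun t => P n t.toNNReal) (Q n))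
    (hP : Tendsto P atTop (𝓝 P₀)) (hQ : Tendsto Q atTop (𝓝 Q₀)) :
    IsMildSolution j a (fun t => P₀ t.toNNReal) Q₀ := by
  have hPt : ∀ t, Tendsto (fun n => P n t) atTop (𝓝 (P₀ t)) := fun t =>
    ((continuous_eval_const (F := ℝ≥0 →ᵇ H) t).tendsto _).comp hP
  refine ⟨(P₀.continuous.comp continuous_real_toNNReal).continuousOn, fun T => ?_, ?_,
    fun w t ht => ?_⟩
  · exact (Lp.memLp Q₀).mono_measure (Measure.restrict_mono Ioc_subset_Ioi_self le_rfl)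
  · obtain ⟨ns, hns, hae⟩ := (tendstoInMeasure_of_tendsto_Lp hQ).exists_seq_tendsto_ae
    filter_upwards [hae, ae_all_iff.2 fun n => (h n).lift] with t h1 h2
    have h3 := (j.continuous.tendsto _).comp h1
    have h4 : Tendsto (fun i => j (Q (ns i) t)) atTop (𝓝 (P₀ t.toNNReal)) := by
      simp only [h2]
      exact (hPt _).comp hns.tendsto_atTop
    exact tendsto_nhds_unique h3 h4
  · let μ := (volume.restrict (Ioi (0 : ℝ))).restrict (Ioc 0 t)
    have hμ : μ = volume.restrict (Ioc 0 t) :=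
      Measure.restrict_restrict_of_subset Ioc_subset_Ioi_self
    have : IsFiniteMeasure μ := by rw [hμ]; infer_instance
    -- For fixed `w` and `t`, the right-hand side is a continuous functional of `q`: its restriction
    -- to `(0, t]` paired with the constant `w`.
    have hcont : Continuous fun q : Lp V 2 (volume.restrict (Ioi (0 : ℝ))) =>
        a.lpPairing μ 2 2 (LpToLpRestrictCLM ℝ V ℝ _ 2 (Ioc 0 t) q) (Lp.const 2 μ w) :=
      ((a.lpPairing μ 2 2).continuous.comp (ContinuousLinearMap.continuous _)).clm_apply
        continuous_const
    have hval : ∀ q : Lp V 2 (volume.restrict (Ioi (0 : ℝ))),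
        a.lpPairing μ 2 2 (LpToLpRestrictCLM ℝ V ℝ _ 2 (Ioc 0 t) q) (Lp.const 2 μ w)
          = ∫ s in (0 : ℝ)..t, a (q s) w := by
      intro q
      rw [ContinuousLinearMap.lpPairing_eq_integral, intervalIntegral.integral_of_le ht, ← hμ]
      refine integral_congr_ae ?_
      filter_upwards [LpToLpRestrictCLM_coeFn ℝ (Ioc 0 t) q, Lp.coeFn_const (p := 2) μ w]
        with s h1 h2
      rw [h1, h2]; rfl
    have hR := ((hcont.tendsto Q₀).comp hQ).neg
    simp only [Function.comp_def, hval] at hR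
    have hL := ((hPt t.toNNReal).inner (𝕜 := ℝ) (tendsto_const_nhds (x := j w))).sub
      ((hPt (0 : ℝ).toNNReal).inner (𝕜 := ℝ) (tendsto_const_nhds (x := j w)))
    exact tendsto_nhds_unique (hL.congr fun n => (h n).eqn w t ht) hR

theorem eq_of_initial (ha : IsCoercive a) (h : IsMildSolution j a ρ r)
    (h' : IsMildSolution j a ρ' r') (h0 : ρ 0 = ρ' 0) {t : ℝ} (ht : 0 ≤ t) : ρ t = ρ' t := by
  have := (h.sub h').norm_le ha ht
  rw [h0, sub_self, norm_zero] at this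
  exact sub_eq_zero.1 (norm_le_zero_iff.1 this)

end IsMildSolution

variable [CompleteSpace V] [CompleteSpace H]

/-- Existence of mild solutions for initial data in the range of the third power of the inverse of
the operator associated with `a`; this range is dense. -/
theorem exists_dense_isMildSolution (j : V →L[ℝ] H) {a : V →L[ℝ] V →L[ℝ] ℝ} (ha : IsCoercive a)
    (hj : ∀ x : H, (∀ w, ⟪x, j w⟫ = 0) → x = 0) :
    Dense {x : H | ∃ ρ r, ρ 0 = x ∧ IsMildSolution j a ρ r} := by
  let e := ha.continuousLinearEquivOfBilin
  let T : H →L[ℝ] V := (e.symm : V →L[ℝ] V).comp (ContinuousLinearMap.adjoint j)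
  have hT : ∀ f w, a (T f) w = ⟪f, j w⟫ := by
    intro f w
    rw [← ha.continuousLinearEquivOfBilin_apply]
    change ⟪e (e.symm (ContinuousLinearMap.adjoint j f)), w⟫ = _
    rw [e.apply_symm_apply, ContinuousLinearMap.adjoint_inner_left]
  let S : H →L[ℝ] H := j.comp T
  have hST : ∀ f, ⟪S f, f⟫ = a (T f) (T f) := fun f => by
    rw [hT, real_inner_comm]; rfl
  obtain ⟨C, hC0, hC⟩ := id ha
  have hS : ∀ f, 0 ≤ ⟪S f, f⟫ := fun f => by
    rw [hST]; exact le_trans (by positivity) (hC (T f))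
  have hSd : DenseRange S := by
    -- If `x` is orthogonal to the range, then `a (T x) (T x) = ⟪S x, x⟫ = 0`, so `T x = 0` by
    -- coercivity, and `x` is orthogonal to the range of `j`.
    have hbot : (LinearMap.range (S : H →ₗ[ℝ] H))ᗮ = ⊥ := by
      rw [eq_bot_iff]
      intro x hx
      have h0 : ⟪S x, x⟫ = 0 := hx (S x) ⟨x, rfl⟩
      rw [hST] at h0
      have hTx : T x = 0 := by
        have h1 := hC (T x)
        rw [h0, mul_assoc] at h1
        have h2 : ‖T x‖ * ‖T x‖ ≤ 0 := nonpos_of_mul_nonpos_right h1 hC0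
        exact norm_eq_zero.1 (mul_self_eq_zero.1 (le_antisymm h2 (mul_self_nonneg _)))
      refine (Submodule.mem_bot ℝ).2 (hj x fun w => ?_)
      rw [← hT, hTx]; simp
    have := Submodule.topologicalClosure_eq_top_iff.2 hbot
    rw [DenseRange, dense_iff_closure_eq]
    exact congrArg (fun K : Submodule ℝ H => (K : Set H)) this
  -- Two factors come from `z 0 = S (S k)`, the third from `ρ = S z`.
  have hS3 : DenseRange fun k => S (S (S k)) :=
    hSd.comp (hSd.comp hSd S.continuous) S.continuous
  refine hS3.mono ?_
  rintro _ ⟨k, rfl⟩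
  obtain ⟨z, hzc, hz0, hz⟩ := exists_solution_degenerate_evolution S hS k
  refine ⟨fun t => S (z t), fun t => T (z t), by simp only [hz0],
    S.continuous.comp_continuousOn hzc, fun t => ?_, Eventually.of_forall fun _ => rfl,
    fun w t ht => ?_⟩
  · have hTc : ContinuousOn (fun t => T (z t)) (Icc 0 t) :=
      (T.continuous.comp_continuousOn hzc).mono Icc_subset_Ici_self
    obtain ⟨B, hB⟩ := isCompact_Icc.exists_bound_of_continuousOn hTc
    refine MemLp.of_bound
      ((hTc.mono Ioc_subset_Icc_self).aestronglyMeasurable measurableSet_Ioc) B ?_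
    filter_upwards [ae_restrict_mem measurableSet_Ioc] with s hs using hB s (Ioc_subset_Icc_self hs)
  · have hzi : IntervalIntegrable z volume 0 t :=
      (hzc.mono (by rw [uIcc_of_le ht]; exact Icc_subset_Ici_self)).intervalIntegrable
    rw [← inner_sub_left, hz t ht, inner_neg_left, real_inner_comm]
    have := (innerSL ℝ (j w)).intervalIntegral_comp_comm hzi
    simp only [innerSL_apply_apply] at this
    rw [← this]
    simp only [hT, real_inner_comm]

/-- Existence of mild solutions on the half-line. -/
theorem exists_isMildSolution (j : V →L[ℝ] H) {a : V →L[ℝ] V →L[ℝ] ℝ} (ha : IsCoercive a)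
    (hj : ∀ x : H, (∀ w, ⟪x, j w⟫ = 0) → x = 0) (u₀ : H) :
    ∃ (P : ℝ≥0 →ᵇ H) (r : ℝ → V), P 0 = u₀ ∧ MemLp r 2 (volume.restrict (Ioi 0)) ∧
      IsMildSolution j a (fun t => P t.toNNReal) r := by
  obtain ⟨u, hu, hlim⟩ := mem_closure_iff_seq_limit.1 (exists_dense_isMildSolution j ha hj u₀)
  have hex : ∀ n, ∃ (P : ℝ≥0 →ᵇ H) (q : Lp V 2 (volume.restrict (Ioi (0 : ℝ)))), P 0 = u n ∧
      IsMildSolution j a (fun t => P t.toNNReal) q := by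
    intro n
    obtain ⟨ρ, r, h0, h⟩ := hu n
    obtain ⟨P, hP0, hP⟩ := h.exists_boundedContinuousFunction ha
    refine ⟨P, (h.memLp_Ioi ha).toLp r, hP0.trans h0, hP.congr (fun _ _ => rfl) ?_⟩
    filter_upwards [(h.memLp_Ioi ha).coeFn_toLp] with t ht using ht.symm
  choose P q hP0 hPq using hex
  -- By linearity the difference of two solutions is a solution, so the energy bound controls its
  -- distance for all times by that of the data.
  have hdP : ∀ n m, dist (P n) (P m) ≤ dist (u n) (u m) := by
    intro n m
    rw [BoundedContinuousFunction.dist_le dist_nonneg]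
    intro t
    have := ((hPq n).sub (hPq m)).norm_le ha t.2
    simpa [dist_eq_norm, hP0] using this
  obtain ⟨C, hC0, hC⟩ := id ha
  have hdq : ∀ n m, dist (q n) (q m) ≤ (√(2 * C))⁻¹ * dist (u n) (u m) := by
    intro n m
    have h := (hPq n).sub (hPq m)
    have hm : MemLp (fun t => q n t - q m t) 2 (volume.restrict (Ioi (0 : ℝ))) :=
      (Lp.memLp (q n)).sub (Lp.memLp (q m))
    have e : hm.toLp _ = q n - q m := by
      refine Lp.ext (hm.coeFn_toLp.trans ?_)
      exact (Lp.coeFn_sub (q n) (q m)).symm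
    have hb := h.norm_toLp_sq_le hC0 hC hm
    rw [e] at hb
    simp only [Real.toNNReal_zero, hP0] at hb
    rw [dist_eq_norm, dist_eq_norm, ← div_eq_inv_mul, le_div_iff₀ (by positivity)]
    refine (sq_le_sq₀ (by positivity) (norm_nonneg _)).1 ?_
    rw [mul_pow, Real.sq_sqrt (by positivity)]
    linarith
  have hu_cauchy := hlim.cauchySeq
  have hPc : CauchySeq P := by
    rw [cauchySeq_iff_tendsto_dist_atTop_0] at hu_cauchy ⊢
    exact squeeze_zero (fun _ => dist_nonneg) (fun p => hdP p.1 p.2) hu_cauchy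
  have hqc : CauchySeq q := by
    rw [cauchySeq_iff_tendsto_dist_atTop_0] at hu_cauchy ⊢
    refine squeeze_zero (fun _ => dist_nonneg) (fun p => hdq p.1 p.2) ?_
    simpa using hu_cauchy.const_mul (√(2 * C))⁻¹
  obtain ⟨P₀, hP⟩ := cauchySeq_tendsto_of_complete hPc
  obtain ⟨q₀, hq⟩ := cauchySeq_tendsto_of_complete hqc
  refine ⟨P₀, q₀, ?_, Lp.memLp q₀, IsMildSolution.of_tendsto hPq hP hq⟩
  have h1 := ((continuous_eval_const (F := ℝ≥0 →ᵇ H) 0).tendsto P₀).comp hP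
  simp only [Function.comp_def, hP0] at h1
  exact tendsto_nhds_unique h1 hlim

end AbstractExistence

/-! ### Distributional derivatives and primitives on the half-line -/

section HalfLineDistributions

open Filter Topology

theorem deriv_smoothTransition_eq_zero {x : ℝ} (hx : x ∉ Icc (0 : ℝ) 1) :
    deriv Real.smoothTransition x = 0 := by
  have hx' : x < 0 ∨ 1 < x := by
    rw [mem_Icc, not_and_or, not_le, not_le] at hx; exact hx
  rcases hx' with h | h
  · have : Real.smoothTransition =ᶠ[𝓝 x] fun _ => 0 := by
      filter_upwards [Iio_mem_nhds h] with y hy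
      exact Real.smoothTransition.zero_of_nonpos (le_of_lt hy)
    rw [this.deriv_eq]; simp
  · have : Real.smoothTransition =ᶠ[𝓝 x] fun _ => 1 := by
      filter_upwards [Ioi_mem_nhds h] with y hy
      exact Real.smoothTransition.one_of_one_le (le_of_lt hy)
    rw [this.deriv_eq]; simp

theorem continuous_deriv_smoothTransition : Continuous (deriv Real.smoothTransition) :=
  (Real.smoothTransition.contDiff (n := 1)).continuous_deriv le_rfl

theorem hasCompactSupport_deriv_smoothTransition :
    HasCompactSupport (deriv Real.smoothTransition) :=
  HasCompactSupport.intro isCompact_Icc fun _ hx => deriv_smoothTransition_eq_zero hx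

theorem integrable_deriv_smoothTransition : Integrable (deriv Real.smoothTransition) :=
  continuous_deriv_smoothTransition.integrable_of_hasCompactSupport
    hasCompactSupport_deriv_smoothTransition

theorem integral_deriv_smoothTransition : ∫ x, deriv Real.smoothTransition x = 1 := by
  rw [← setIntegral_eq_integral_of_forall_compl_eq_zero (s := Icc (0 : ℝ) 1)
    fun x hx => deriv_smoothTransition_eq_zero hx, integral_Icc_eq_integral_Ioc,
    ← intervalIntegral.integral_of_le zero_le_one, intervalIntegral.integral_deriv_eq_sub
    (fun x _ => Real.smoothTransition.contDiff (n := 1) |>.differentiable (by simp) x)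
    (continuous_deriv_smoothTransition.intervalIntegrable _ _)]
  simp

/-- Steep smooth steps located at `s` have derivatives approximating the Dirac mass at `s`. -/
theorem tendsto_integral_deriv_step_mul {f : ℝ → ℝ} (hf : Continuous f) {b : ℝ}
    (hb : ∀ x, |f x| ≤ b) (s : ℝ) :
    Tendsto (fun n : ℕ => ∫ x, ((n : ℝ) + 1) *
      deriv Real.smoothTransition (((n : ℝ) + 1) * (x - s) - 1) * f x) atTop (𝓝 (f s)) := by
  -- This is the integrand after the substitution `y = (n + 1)(x - s) - 1`, which carries the
  -- `n`-dependence into the argument of `f`.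
  let F : ℕ → ℝ → ℝ := fun n y =>
    deriv Real.smoothTransition y * f (s + (y + 1) * (1 / ((n : ℝ) + 1)))
  have hF : ∀ n : ℕ, ∫ x, ((n : ℝ) + 1) *
      deriv Real.smoothTransition (((n : ℝ) + 1) * (x - s) - 1) * f x = ∫ y, F n y := by
    intro n
    have hn : (0 : ℝ) < (n : ℝ) + 1 := by positivity
    have e1 : ∀ x, ((n : ℝ) + 1) *
        deriv Real.smoothTransition (((n : ℝ) + 1) * (x - s) - 1) * f x
        = ((n : ℝ) + 1) * (fun z => F n (z - (((n : ℝ) + 1) * s + 1))) (((n : ℝ) + 1) * x) := by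
      intro x
      have e2 : ((n : ℝ) + 1) * x - (((n : ℝ) + 1) * s + 1) = ((n : ℝ) + 1) * (x - s) - 1 := by ring
      have e3 : s + (((n : ℝ) + 1) * (x - s) - 1 + 1) * (1 / ((n : ℝ) + 1)) = x := by
        field_simp; ring
      simp only [F]
      rw [e2, e3, mul_assoc]
    simp only [e1]
    rw [integral_const_mul, Measure.integral_comp_mul_left
      (fun z => F n (z - (((n : ℝ) + 1) * s + 1))), integral_sub_right_eq_self (F n),
      abs_of_pos (inv_pos.2 hn), smul_eq_mul, mul_inv_cancel_left₀ hn.ne']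
  simp only [hF]
  have hlim : Tendsto (fun n => ∫ y, F n y) atTop
      (𝓝 (∫ y, deriv Real.smoothTransition y * f s)) := by
    refine tendsto_integral_of_dominated_convergence
      (fun y => ‖deriv Real.smoothTransition y‖ * b) (fun n => ?_)
      (integrable_deriv_smoothTransition.norm.mul_const b) (fun n => ?_) ?_
    · exact (continuous_deriv_smoothTransition.mul
        (hf.comp (by fun_prop))).aestronglyMeasurable
    · refine Eventually.of_forall fun y => ?_
      rw [norm_mul]
      exact mul_le_mul_of_nonneg_left (hb _) (norm_nonneg _)
    · refine Eventually.of_forall fun y => Tendsto.const_mul _ ?_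
      have h0 : Tendsto (fun n : ℕ => s + (y + 1) * (1 / ((n : ℝ) + 1))) atTop (𝓝 s) := by
        simpa using (tendsto_one_div_add_atTop_nhds_zero_nat.const_mul (y + 1)).const_add s
      exact (hf.tendsto s).comp h0
  rwa [integral_mul_const, integral_deriv_smoothTransition, one_mul] at hlim

/-- Smooth approximations of the indicator function of `(0, t]`. -/
def smoothIndicator (t : ℝ) (n : ℕ) (x : ℝ) : ℝ :=
  Real.smoothTransition (((n : ℝ) + 1) * (x - 0) - 1) -
    Real.smoothTransition (((n : ℝ) + 1) * (x - t) - 1)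

theorem smoothIndicator_eq_zero {t : ℝ} (ht : 0 ≤ t) (n : ℕ) {x : ℝ}
    (hx : x ∉ Icc (1 / ((n : ℝ) + 1)) (t + 2 * (1 / ((n : ℝ) + 1)))) :
    smoothIndicator t n x = 0 := by
  have hn : (0 : ℝ) < (n : ℝ) + 1 := by positivity
  have hx' : x < 1 / ((n : ℝ) + 1) ∨ t + 2 * (1 / ((n : ℝ) + 1)) < x := by
    rw [mem_Icc, not_and_or, not_le, not_le] at hx; exact hx
  rw [smoothIndicator]
  rcases hx' with h | h
  · rw [lt_div_iff₀ hn] at h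
    rw [Real.smoothTransition.zero_of_nonpos, Real.smoothTransition.zero_of_nonpos, sub_self]
    · nlinarith
    · linarith
  · have h' : 2 ≤ ((n : ℝ) + 1) * (x - t) := by
      have : 2 * (1 / ((n : ℝ) + 1)) ≤ x - t := by linarith
      rw [mul_one_div, div_le_iff₀ hn] at this
      linarith
    rw [Real.smoothTransition.one_of_one_le, Real.smoothTransition.one_of_one_le, sub_self]
    · linarith
    · nlinarith

theorem contDiff_smoothIndicator (t : ℝ) (n : ℕ) {k : ℕ∞} :
    ContDiff ℝ k (smoothIndicator t n) := by
  unfold smoothIndicator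
  exact (Real.smoothTransition.contDiff.comp (by fun_prop)).sub
    (Real.smoothTransition.contDiff.comp (by fun_prop))

/-- The `- 1` in `smoothIndicator` delays each step by `1 / (n + 1)`. The support is therefore
compact in the open half-line, as required of a test function. -/
theorem tsupport_smoothIndicator_subset {t : ℝ} (ht : 0 ≤ t) (n : ℕ) :
    tsupport (smoothIndicator t n) ⊆
      Icc (1 / ((n : ℝ) + 1)) (t + 2 * (1 / ((n : ℝ) + 1))) := by
  refine closure_minimal (fun x hx => ?_) isClosed_Icc
  by_contra h
  exact hx (smoothIndicator_eq_zero ht n h)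

theorem abs_smoothIndicator_le (t : ℝ) (n : ℕ) (x : ℝ) : |smoothIndicator t n x| ≤ 1 := by
  rw [smoothIndicator, abs_le]
  constructor <;>
  linarith [Real.smoothTransition.nonneg (((n : ℝ) + 1) * (x - 0) - 1),
    Real.smoothTransition.le_one (((n : ℝ) + 1) * (x - 0) - 1),
    Real.smoothTransition.nonneg (((n : ℝ) + 1) * (x - t) - 1),
    Real.smoothTransition.le_one (((n : ℝ) + 1) * (x - t) - 1)]

/-- The delayed step at `t` still vanishes at `x = t`, hence the closed right endpoint of the limit
interval. -/
theorem tendsto_smoothIndicator {t x : ℝ} (hx : 0 < x) :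
    Tendsto (fun n => smoothIndicator t n x) atTop
      (𝓝 ((Ioc 0 t).indicator (fun _ => (1 : ℝ)) x)) := by
  have hone : ∀ s, s < x → Tendsto (fun n : ℕ =>
      Real.smoothTransition (((n : ℝ) + 1) * (x - s) - 1)) atTop (𝓝 1) := by
    intro s hs
    refine tendsto_const_nhds.congr' ?_
    have h1 : Tendsto (fun n : ℕ => ((n : ℝ) + 1) * (x - s)) atTop atTop :=
      (tendsto_atTop_add_const_right _ 1 tendsto_natCast_atTop_atTop).atTop_mul_const
        (sub_pos.2 hs)
    filter_upwards [h1.eventually_ge_atTop 2] with n hn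
    rw [Real.smoothTransition.one_of_one_le]
    linarith
  by_cases hxt : x ≤ t
  · rw [indicator_of_mem (mem_Ioc.2 ⟨hx, hxt⟩)]
    refine (hone 0 hx).congr fun n => ?_
    have h0 : Real.smoothTransition (((n : ℝ) + 1) * (x - t) - 1) = 0 :=
      Real.smoothTransition.zero_of_nonpos
        (by nlinarith [(by positivity : (0 : ℝ) < (n : ℝ) + 1)])
    simp [smoothIndicator, h0]
  · rw [indicator_of_notMem (fun h => hxt h.2)]
    simpa [smoothIndicator] using (hone 0 hx).sub (hone t (not_le.1 hxt))

/-- A bounded continuous function whose distributional derivative on `(0, ∞)` is locally integrable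
up to `0` is a primitive of this derivative. -/
theorem sub_eq_integral_of_forall_testFunction {f g : ℝ → ℝ} (hf : Continuous f) {b : ℝ}
    (hb : ∀ x, |f x| ≤ b) (hg : ∀ T, IntegrableOn g (Ioc 0 T))
    (h : ∀ φ : 𝓓((⟨Ioi 0, isOpen_Ioi⟩ : Opens ℝ), ℝ),
      ∫ t in Ioi (0 : ℝ), deriv φ t * f t = -∫ t in Ioi (0 : ℝ), φ t * g t)
    {t : ℝ} (ht : 0 ≤ t) : f t - f 0 = ∫ s in (0 : ℝ)..t, g s := by
  have hts : ∀ n : ℕ, tsupport (smoothIndicator t n) ⊆ Ioi 0 := fun n =>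
    (tsupport_smoothIndicator_subset ht n).trans fun x hx =>
      lt_of_lt_of_le (by positivity : (0 : ℝ) < 1 / ((n : ℝ) + 1)) hx.1
  let φ : ℕ → 𝓓((⟨Ioi 0, isOpen_Ioi⟩ : Opens ℝ), ℝ) := fun n =>
    ⟨smoothIndicator t n, contDiff_smoothIndicator t n,
      isCompact_Icc.of_isClosed_subset (isClosed_tsupport _)
        (tsupport_smoothIndicator_subset ht n), hts n⟩
  have hφ : ∀ n x, φ n x = smoothIndicator t n x := fun _ _ => rfl
  have hderiv : ∀ (n : ℕ) x, deriv (φ n) x =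
      ((n : ℝ) + 1) * deriv Real.smoothTransition (((n : ℝ) + 1) * (x - 0) - 1) -
      ((n : ℝ) + 1) * deriv Real.smoothTransition (((n : ℝ) + 1) * (x - t) - 1) := by
    intro n x
    have hstep : ∀ s, HasDerivAt
        (fun x => Real.smoothTransition (((n : ℝ) + 1) * (x - s) - 1))
        (((n : ℝ) + 1) * deriv Real.smoothTransition (((n : ℝ) + 1) * (x - s) - 1)) x := by
      intro s
      have h1 : HasDerivAt (fun x => ((n : ℝ) + 1) * (x - s) - 1) ((n : ℝ) + 1) x := by
        simpa using (((hasDerivAt_id x).sub_const s).const_mul ((n : ℝ) + 1)).sub_const 1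
      have h2 := ((Real.smoothTransition.contDiff (n := 1)).differentiable (by simp)
        (((n : ℝ) + 1) * (x - s) - 1)).hasDerivAt
      rw [mul_comm]
      exact h2.comp x h1
    exact ((hstep 0).sub (hstep t)).deriv
  -- The derivative of the test function is an approximate Dirac mass at `0` minus one at `t`.
  have hL : ∀ n, ∫ x in Ioi (0 : ℝ), deriv (φ n) x * f x =
      (∫ x, ((n : ℝ) + 1) * deriv Real.smoothTransition (((n : ℝ) + 1) * (x - 0) - 1) * f x) -
      ∫ x, ((n : ℝ) + 1) * deriv Real.smoothTransition (((n : ℝ) + 1) * (x - t) - 1) * f x := by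
    intro n
    have hi : ∀ s, Integrable fun x =>
        ((n : ℝ) + 1) * deriv Real.smoothTransition (((n : ℝ) + 1) * (x - s) - 1) * f x := by
      intro s
      have hn : ((n : ℝ) + 1) ≠ 0 := by positivity
      have h1 : Integrable fun x => deriv Real.smoothTransition (((n : ℝ) + 1) * (x - s) - 1) := by
        have := ((integrable_deriv_smoothTransition.comp_sub_right 1).comp_mul_left'
          hn).comp_sub_right s
        exact this
      refine (h1.const_mul ((n : ℝ) + 1)).mul_bdd (c := b) hf.aestronglyMeasurable ?_
      exact Eventually.of_forall hb
    rw [← integral_sub (hi 0) (hi t), setIntegral_eq_integral_of_forall_compl_eq_zero]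
    · refine integral_congr_ae (Eventually.of_forall fun x => ?_)
      simp only [hderiv]; ring
    · intro x hx
      have : deriv (φ n) x = 0 := by
        by_contra hne
        exact hx (hts n ((support_deriv_subset (f := φ n)) hne))
      rw [this, zero_mul]
  have hlimL : Tendsto (fun n => ∫ x in Ioi (0 : ℝ), deriv (φ n) x * f x) atTop
      (𝓝 (f 0 - f t)) := by
    simp only [hL]
    exact (tendsto_integral_deriv_step_mul hf hb 0).sub (tendsto_integral_deriv_step_mul hf hb t)
  have hlimR : Tendsto (fun n => ∫ x in Ioi (0 : ℝ), φ n x * g x) atTop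
      (𝓝 (∫ x in Ioi (0 : ℝ), (Ioc 0 t).indicator g x)) := by
    -- All the test functions live in `(0, t + 2]` because `1 / (n + 1) ≤ 1`. Truncating `g` there
    -- gives an integrable majorant, `g` itself being integrable only on bounded intervals.
    have hgm : AEStronglyMeasurable ((Ioc 0 (t + 2)).indicator g) (volume.restrict (Ioi 0)) :=
      ((integrable_indicator_iff measurableSet_Ioc).2 (hg (t + 2))).1.restrict
    have hsupp : ∀ n x, φ n x * g x = φ n x * (Ioc 0 (t + 2)).indicator g x := by
      intro n x
      by_cases hx : x ∈ Ioc 0 (t + 2)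
      · rw [indicator_of_mem hx]
      · rw [hφ, smoothIndicator_eq_zero ht n, zero_mul, zero_mul]
        intro hx'
        refine hx ⟨lt_of_lt_of_le (by positivity) hx'.1, hx'.2.trans ?_⟩
        have : 1 / ((n : ℝ) + 1) ≤ 1 := by
          rw [div_le_one (by positivity)]; linarith [(Nat.cast_nonneg n : (0 : ℝ) ≤ n)]
        linarith
    refine tendsto_integral_of_dominated_convergence
      (fun x => ‖(Ioc 0 (t + 2)).indicator g x‖) (fun n => ?_) ?_ (fun n => ?_) ?_
    · simp only [hsupp]
      exact (φ n).continuous.aestronglyMeasurable.mul hgm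
    · exact ((integrable_indicator_iff measurableSet_Ioc).2 (hg (t + 2))).norm.restrict
    · refine Eventually.of_forall fun x => ?_
      rw [hsupp, norm_mul]
      exact mul_le_of_le_one_left (norm_nonneg _) (abs_smoothIndicator_le t n x)
    · filter_upwards [ae_restrict_mem measurableSet_Ioi] with x hx
      have := (tendsto_smoothIndicator (t := t) hx).mul_const (g x)
      have e : (Ioc 0 t).indicator (fun _ => (1 : ℝ)) x * g x = (Ioc 0 t).indicator g x := by
        by_cases hx' : x ∈ Ioc 0 t
        · rw [indicator_of_mem hx', indicator_of_mem hx', one_mul]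
        · rw [indicator_of_notMem hx', indicator_of_notMem hx', zero_mul]
      rwa [e] at this
  have hfin := tendsto_nhds_unique (hlimL.congr fun n => h (φ n)) hlimR.neg
  rw [setIntegral_indicator measurableSet_Ioc,
    inter_eq_self_of_subset_right Ioc_subset_Ioi_self,
    ← intervalIntegral.integral_of_le ht] at hfin
  linarith

theorem intervalIntegrable_of_forall_integrableOn {E : Type*} [NormedAddCommGroup E] {g : ℝ → E}
    (hg : ∀ T, IntegrableOn g (Ioc 0 T)) {T : ℝ} (hT : 0 ≤ T) :
    IntervalIntegrable g volume 0 T :=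
  (intervalIntegrable_iff_integrableOn_Ioc_of_le hT).2 (hg T)

/-- A primitive is almost everywhere differentiable. -/
theorem ae_hasDerivAt_of_sub_eq_integral {f g : ℝ → ℝ} (hg : ∀ T, IntegrableOn g (Ioc 0 T))
    (h : ∀ t, 0 ≤ t → f t - f 0 = ∫ s in (0 : ℝ)..t, g s) :
    ∀ᵐ t ∂(volume.restrict (Ioi (0 : ℝ))), HasDerivAt f (g t) t := by
  have hall : ∀ᵐ t, ∀ n : ℕ, t ∈ uIcc (0 : ℝ) n → ∀ c ∈ uIcc (0 : ℝ) n,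
      HasDerivAt (fun x => ∫ s in c..x, g s) (g t) t :=
    ae_all_iff.2 fun n =>
      (intervalIntegrable_of_forall_integrableOn hg n.cast_nonneg).ae_hasDerivAt_integral
  filter_upwards [ae_restrict_of_ae hall, ae_restrict_mem measurableSet_Ioi] with t ht htpos
  obtain ⟨n, hn⟩ := exists_nat_ge t
  have h1 := ht n (by rw [uIcc_of_le n.cast_nonneg]; exact ⟨le_of_lt htpos, hn⟩) 0 left_mem_uIcc
  refine (h1.const_add (f 0)).congr_of_eventuallyEq ?_
  filter_upwards [Ioi_mem_nhds htpos] with x hx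
  rw [← h x (le_of_lt hx)]; ring

/-- The distributional derivative of a primitive. -/
theorem integral_deriv_mul_eq_neg_of_sub_eq_integral {f g : ℝ → ℝ}
    (hg : ∀ T, IntegrableOn g (Ioc 0 T))
    (h : ∀ t, 0 ≤ t → f t - f 0 = ∫ s in (0 : ℝ)..t, g s)
    (φ : 𝓓((⟨Ioi 0, isOpen_Ioi⟩ : Opens ℝ), ℝ)) :
    ∫ t in Ioi (0 : ℝ), deriv φ t * f t = -∫ t in Ioi (0 : ℝ), φ t * g t := by
  obtain ⟨b, hb⟩ := φ.hasCompactSupport.isCompact.bddAbove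
  let T : ℝ := max b 0 + 1
  have hT : 0 ≤ T := by positivity
  have hbT : b < T := lt_of_le_of_lt (le_max_left b 0) (lt_add_one _)
  have hφ : ∀ x, x ∈ Ioi (0 : ℝ) \ Ioc 0 T → x ∉ tsupport φ := fun x hx hxs =>
    hx.2 ⟨hx.1, (hb hxs).trans hbT.le⟩
  have hφ0 : φ 0 = 0 := image_eq_zero_of_notMem_tsupport fun h0 =>
    lt_irrefl (0 : ℝ) (φ.tsupport_subset h0)
  have hφT : φ T = 0 := image_eq_zero_of_notMem_tsupport fun h0 => (hb h0).not_gt hbT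
  have hφd : ContDiff ℝ 1 φ := φ.contDiff.of_le (by simp)
  have hred : ∀ u v : ℝ → ℝ, (∀ x, x ∉ tsupport φ → u x = 0) →
      ∫ t in Ioi (0 : ℝ), u t * v t = ∫ t in (0 : ℝ)..T, u t * v t := by
    intro u v hu
    rw [intervalIntegral.integral_of_le hT]
    refine (setIntegral_eq_of_subset_of_forall_sdiff_eq_zero measurableSet_Ioi
      Ioc_subset_Ioi_self fun x hx => ?_)
    rw [hu x (hφ x hx), zero_mul]
  rw [hred _ _ fun x hx => by
      by_contra hne; exact hx (support_deriv_subset (f := φ) hne),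
    hred _ _ fun x hx => image_eq_zero_of_notMem_tsupport hx]
  have hgi := intervalIntegrable_of_forall_integrableOn hg hT
  -- `F` is only absolutely continuous, which suffices to integrate by parts against `φ`; the
  -- boundary terms vanish because `φ` is zero at both ends.
  let F : ℝ → ℝ := fun x => ∫ s in (0 : ℝ)..x, g s
  have hFac : AbsolutelyContinuousOnInterval F 0 T :=
    hgi.absolutelyContinuousOnInterval_intervalIntegral left_mem_uIcc
  have hφac : AbsolutelyContinuousOnInterval φ 0 T :=
    hφd.contDiffOn.absolutelyContinuousOnInterval
  have hibp := hFac.integral_mul_deriv_eq_deriv_mul hφac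
  have hF0 : F 0 = 0 := intervalIntegral.integral_same
  rw [hφ0, hφT, mul_zero, mul_zero, sub_zero, zero_sub] at hibp
  have hdc : Continuous (deriv φ) := hφd.continuous_deriv le_rfl
  have e1 : ∫ t in (0 : ℝ)..T, deriv φ t * f t =
      (∫ t in (0 : ℝ)..T, f 0 * deriv φ t) + ∫ t in (0 : ℝ)..T, F t * deriv φ t := by
    rw [← intervalIntegral.integral_add]
    · refine intervalIntegral.integral_congr fun t ht => ?_
      rw [uIcc_of_le hT] at ht
      simp only [F]
      rw [← h t ht.1]; ring
    · exact (hdc.const_mul _).intervalIntegrable _ _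
    · exact (hdc.intervalIntegrable _ _).continuousOn_mul hFac.continuousOn
  have e2 : ∫ t in (0 : ℝ)..T, deriv φ t = 0 := by
    rw [intervalIntegral.integral_deriv_eq_sub
      (fun x _ => hφd.differentiable (by simp) x) (hdc.intervalIntegrable _ _), hφ0, hφT, sub_zero]
  rw [e1, intervalIntegral.integral_const_mul, e2, mul_zero, zero_add, hibp]
  congr 1
  refine intervalIntegral.integral_congr_ae ?_
  filter_upwards [hgi.ae_hasDerivAt_integral] with x hx hmem
  rw [(hx (uIoc_subset_uIcc hmem) 0 left_mem_uIcc).deriv, mul_comm]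

end HalfLineDistributions

/-! ### Closedness of `𝓗` and `𝓥`, test functions and uniqueness of gradients -/

namespace DiffusionDomain

open Filter Topology

variable {N : ℕ} (D : DiffusionDomain N)

theorem restrict_restrict_B (l : Fin D.m) :
    (volume.restrict (D.Ω : Set (EuclideanSpace ℝ (Fin N)))).restrict (D.B l)
      = volume.restrict (D.B l) :=
  Measure.restrict_restrict_of_subset (D.B_subset_Ω l)

theorem volume_Ω_lt_top : volume (D.Ω : Set (EuclideanSpace ℝ (Fin N))) < ∞ :=
  D.isBounded_Ω.measure_lt_top

instance isFiniteMeasure_restrict_Ω :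
    IsFiniteMeasure (volume.restrict (D.Ω : Set (EuclideanSpace ℝ (Fin N)))) :=
  ⟨by simpa using D.volume_Ω_lt_top⟩

/-- The mean over `B_l` is an inner product with the constant `1`, so each constraint equates two
continuous functions of `u`: its restriction to `B_l` and the corresponding constant. -/
theorem isClosed_H : IsClosed (D.H : Set D.L2) := by
  have hset : (D.H : Set D.L2) = ⋂ l, {u : D.L2 |
      LpToLpRestrictCLM _ ℝ ℝ _ 2 (D.B l) u =
        Lp.constL 2 ((volume.restrict (D.Ω : Set (EuclideanSpace ℝ (Fin N)))).restrict (D.B l)) ℝ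
          ((volume.real (D.B l))⁻¹ * inner ℝ (Lp.const 2 _ (1 : ℝ))
            (LpToLpRestrictCLM _ ℝ ℝ _ 2 (D.B l) u))} := by
    ext u
    simp only [SetLike.mem_coe, mem_iInter, mem_ofPred_eq]
    refine forall_congr' fun l => ?_
    have hav : (volume.real (D.B l))⁻¹ * inner ℝ (Lp.const 2 _ (1 : ℝ))
        (LpToLpRestrictCLM _ ℝ ℝ
          (volume.restrict (D.Ω : Set (EuclideanSpace ℝ (Fin N)))) 2 (D.B l) u)
        = ⨍ y in D.B l, u y := by
      rw [average_eq, measureReal_restrict_apply_univ, smul_eq_mul, L2.inner_def]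
      congr 1
      rw [← D.restrict_restrict_B l]
      refine integral_congr_ae ?_
      filter_upwards [LpToLpRestrictCLM_coeFn ℝ (D.B l) u,
        Lp.coeFn_const (p := 2)
          ((volume.restrict (D.Ω : Set (EuclideanSpace ℝ (Fin N)))).restrict (D.B l)) (1 : ℝ)]
        with x h1 h2
      rw [h1, h2]; simp
    rw [hav, Lp.ext_iff]
    have hm : ∀ P : EuclideanSpace ℝ (Fin N) → Prop, (∀ᵐ x ∂(volume.restrict (D.B l)), P x) ↔
        ∀ᵐ x ∂((volume.restrict (D.Ω : Set (EuclideanSpace ℝ (Fin N)))).restrict (D.B l)), P x :=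
      fun P => by rw [D.restrict_restrict_B l]
    rw [hm]
    have h1 := LpToLpRestrictCLM_coeFn ℝ (D.B l) u
    have h2 := Lp.coeFn_const (p := 2)
      ((volume.restrict (D.Ω : Set (EuclideanSpace ℝ (Fin N)))).restrict (D.B l))
      (⨍ y in D.B l, u y)
    constructor
    · intro h
      filter_upwards [h, h1, h2] with x h3 h4 h5
      exact h4.trans (h3.trans h5.symm)
    · intro h
      filter_upwards [h, h1, h2] with x h3 h4 h5
      exact h4.symm.trans (h3.trans h5)
  rw [hset]
  refine isClosed_iInter fun l => isClosed_eq (ContinuousLinearMap.continuous _) ?_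
  refine (ContinuousLinearMap.continuous _).comp (continuous_const.mul ?_)
  exact continuous_const.inner (ContinuousLinearMap.continuous _)

theorem isClosed_V : IsClosed (D.V : Set D.L2Pair) := by
  have : (D.V : Set D.L2Pair) = (D.H10 : Set D.L2Pair) ∩
      (WithLp.fstL 2 ℝ D.L2 D.L2Vec) ⁻¹' (D.H : Set D.L2) := rfl
  rw [this]
  exact (Submodule.isClosed_topologicalClosure _).inter
    (D.isClosed_H.preimage (ContinuousLinearMap.continuous _))

instance completeSpace_H : CompleteSpace D.H := D.isClosed_H.completeSpace_coe

instance completeSpace_V : CompleteSpace D.V := D.isClosed_V.completeSpace_coe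

theorem span_testPairs : (Submodule.span ℝ D.testPairs : Set D.L2Pair) = D.testPairs := by
  refine subset_antisymm (fun p hp => ?_) Submodule.subset_span
  refine Submodule.span_induction (p := fun q _ => q ∈ D.testPairs) (fun _ h => h) ?_ ?_ ?_ hp
  · refine ⟨0, ?_, ?_⟩
    · filter_upwards [Lp.coeFn_zero ℝ 2
        (volume.restrict (D.Ω : Set (EuclideanSpace ℝ (Fin N))))] with x hx
      simpa using hx
    · filter_upwards [Lp.coeFn_zero (EuclideanSpace ℝ (Fin N)) 2
        (volume.restrict (D.Ω : Set (EuclideanSpace ℝ (Fin N))))] with x hx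
      have h0 : ((0 : 𝓓(D.Ω, ℝ)) : EuclideanSpace ℝ (Fin N) → ℝ) = fun _ => 0 := rfl
      rw [h0, gradient_fun_const]
      simpa using hx
  · rintro q q' - - ⟨φ, h1, h2⟩ ⟨ψ, h3, h4⟩
    refine ⟨φ + ψ, ?_, ?_⟩
    · filter_upwards [h1, h3, Lp.coeFn_add q.fst q'.fst] with x e1 e2 e3
      rw [WithLp.add_fst, e3, Pi.add_apply, e1, e2]; rfl
    · filter_upwards [h2, h4, Lp.coeFn_add q.snd q'.snd] with x e1 e2 e3
      have hd : ∀ χ : 𝓓(D.Ω, ℝ), DifferentiableAt ℝ χ x := fun χ =>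
        (χ.contDiff.of_le (by simp) : ContDiff ℝ 1 χ).differentiable (by simp) x
      rw [WithLp.add_snd, e3, Pi.add_apply, e1, e2]
      have h0 : ((φ + ψ : 𝓓(D.Ω, ℝ)) : EuclideanSpace ℝ (Fin N) → ℝ) = φ + ψ := rfl
      rw [h0, gradient, gradient, gradient, fderiv_add (hd φ) (hd ψ), map_add]
  · rintro c q - ⟨φ, h1, h2⟩
    refine ⟨c • φ, ?_, ?_⟩
    · filter_upwards [h1, Lp.coeFn_smul c q.fst] with x e1 e3
      rw [WithLp.smul_fst, e3, Pi.smul_apply, e1]; rfl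
    · filter_upwards [h2, Lp.coeFn_smul c q.snd] with x e1 e3
      have hd : ∀ χ : 𝓓(D.Ω, ℝ), DifferentiableAt ℝ χ x := fun χ =>
        (χ.contDiff.of_le (by simp) : ContDiff ℝ 1 χ).differentiable (by simp) x
      rw [WithLp.smul_snd, e3, Pi.smul_apply, e1]
      have h0 : ((c • φ : 𝓓(D.Ω, ℝ)) : EuclideanSpace ℝ (Fin N) → ℝ) = c • φ := rfl
      rw [h0, gradient, gradient, fderiv_const_smul (hd φ)]
      simp

/-- Induction principle for `H¹₀(Ω)`: a closed condition has to be checked on test functions. -/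
theorem H10_induction {P : D.L2Pair → Prop} (hP : IsClosed {p | P p})
    (htest : ∀ p ∈ D.testPairs, P p) {p : D.L2Pair} (hp : p ∈ D.H10) : P p := by
  have hp' : p ∈ closure D.testPairs := by
    rw [← D.span_testPairs]
    exact hp
  exact closure_minimal (fun q hq => htest q hq) hP hp'

/-- The pair `(φ, ∇φ)` of a test function. -/
theorem exists_mem_testPairs (φ : 𝓓(D.Ω, ℝ)) : ∃ p ∈ D.H10,
    (∀ᵐ x ∂(volume.restrict (D.Ω : Set (EuclideanSpace ℝ (Fin N)))), p.fst x = φ x) := by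
  have hφd : ContDiff ℝ 1 φ := φ.contDiff.of_le (by simp)
  have hg : Continuous (gradient φ) :=
    (InnerProductSpace.toDual ℝ (EuclideanSpace ℝ (Fin N))).symm.continuous.comp
      (hφd.continuous_fderiv (by simp))
  have hgs : HasCompactSupport (gradient φ) :=
    (φ.hasCompactSupport.fderiv (𝕜 := ℝ)).comp_left (map_zero _)
  have h1 : MemLp φ 2 (volume.restrict (D.Ω : Set (EuclideanSpace ℝ (Fin N)))) :=
    (φ.continuous.memLp_of_hasCompactSupport φ.hasCompactSupport).restrict _
  have h2 : MemLp (gradient φ) 2 (volume.restrict (D.Ω : Set (EuclideanSpace ℝ (Fin N)))) :=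
    (hg.memLp_of_hasCompactSupport hgs).restrict _
  refine ⟨WithLp.toLp 2 (h1.toLp φ, h2.toLp _), ?_, h1.coeFn_toLp⟩
  exact Submodule.le_topologicalClosure _ (Submodule.subset_span ⟨φ, h1.coeFn_toLp, h2.coeFn_toLp⟩)

/-- The fundamental lemma of the calculus of variations for vector fields on `Ω`. -/
theorem ae_eq_zero_of_forall_testFunction {f : EuclideanSpace ℝ (Fin N) → EuclideanSpace ℝ (Fin N)}
    (hf : IntegrableOn f (D.Ω : Set (EuclideanSpace ℝ (Fin N))))
    (h : ∀ (φ : 𝓓(D.Ω, ℝ)) (v : EuclideanSpace ℝ (Fin N)),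
      ∫ x in (D.Ω : Set (EuclideanSpace ℝ (Fin N))), inner ℝ (f x) v * φ x = 0) :
    ∀ᵐ x ∂(volume.restrict (D.Ω : Set (EuclideanSpace ℝ (Fin N)))), f x = 0 := by
  rw [ae_restrict_iff' D.Ω.isOpen.measurableSet]
  refine D.Ω.isOpen.ae_eq_zero_of_integral_contDiff_smul_eq_zero hf.locallyIntegrableOn
    fun g hg hgc hgs => ?_
  let φ : 𝓓(D.Ω, ℝ) := ⟨g, hg, hgc, hgs⟩
  have hred : ∫ x, g x • f x = ∫ x in (D.Ω : Set (EuclideanSpace ℝ (Fin N))), g x • f x := by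
    rw [setIntegral_eq_integral_of_forall_compl_eq_zero]
    intro x hx
    rw [image_eq_zero_of_notMem_tsupport fun h => hx (hgs h), zero_smul]
  obtain ⟨b, hb⟩ := hg.continuous.bounded_above_of_compact_support hgc
  have hi : IntegrableOn (fun x => g x • f x) (D.Ω : Set (EuclideanSpace ℝ (Fin N))) :=
    Integrable.bdd_smul hf b hg.continuous.aestronglyMeasurable (Eventually.of_forall hb)
  rw [hred]
  refine ext_inner_right ℝ fun v => ?_
  rw [inner_zero_left, real_inner_comm, ← integral_inner hi v, ← h φ v]
  refine integral_congr_ae (Eventually.of_forall fun x => ?_)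
  simp only [real_inner_smul_right]
  rw [real_inner_comm, mul_comm]; rfl

/-- Weak gradients are unique by the fundamental lemma, so the second component is determined by the
first. Consequently two lifts of the same `ρ` agree almost everywhere. -/
theorem toFun_injective : Function.Injective D.toFun := by
  intro p q hpq
  have hp := D.hasWeakGradient_of_mem_H10 p.2.1
  have hq := D.hasWeakGradient_of_mem_H10 q.2.1
  have hi : ∀ g : D.L2Vec, IntegrableOn g (D.Ω : Set (EuclideanSpace ℝ (Fin N))) := fun g =>
    (Lp.memLp g).integrable (by norm_num)
  have hgrad : (p : D.L2Pair).snd = (q : D.L2Pair).snd := by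
    have h0 := D.ae_eq_zero_of_forall_testFunction
      ((hi (p : D.L2Pair).snd).sub (hi (q : D.L2Pair).snd)) fun φ v => ?_
    · refine Lp.ext ?_
      filter_upwards [h0] with x hx using sub_eq_zero.1 hx
    · obtain ⟨b, hb⟩ := φ.continuous.bounded_above_of_compact_support φ.hasCompactSupport
      have hiφ : ∀ g : D.L2Vec, IntegrableOn (fun x => inner ℝ (g x) v * φ x)
          (D.Ω : Set (EuclideanSpace ℝ (Fin N))) := fun g =>
        ((hi g).inner_const v).mul_bdd (c := b)
          φ.continuous.aestronglyMeasurable (Eventually.of_forall hb)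
      simp only [Pi.sub_apply, inner_sub_left, sub_mul]
      rw [integral_sub (hiφ _) (hiφ _)]
      have e1 := hp φ v
      have e2 := hq φ v
      have e3 : (p : D.L2Pair).fst = (q : D.L2Pair).fst := hpq
      rw [e3] at e1
      linarith
  refine Subtype.ext ?_
  refine (WithLp.equiv 2 _).injective (Prod.ext hpq hgrad)

end DiffusionDomain

/-! ### Truncations that detect a level set -/

section ArctanTruncation

open Filter Topology

/-- Smooth bounded functions vanishing at `0` whose derivatives approximate the indicator function
of the point `c`. -/
def arctanTruncation (c k s : ℝ) : ℝ := k⁻¹ * (Real.arctan (k * (s - c)) - Real.arctan (k * (0 - c)))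

theorem arctanTruncation_zero (c k : ℝ) : arctanTruncation c k 0 = 0 := by
  simp [arctanTruncation]

theorem abs_arctanTruncation_le {k : ℝ} (hk : 0 < k) (c s : ℝ) :
    |arctanTruncation c k s| ≤ k⁻¹ * Real.pi := by
  rw [arctanTruncation, abs_mul, abs_of_pos (inv_pos.2 hk)]
  refine mul_le_mul_of_nonneg_left ?_ (inv_pos.2 hk).le
  rw [abs_le]
  constructor <;>
  linarith [Real.arctan_lt_pi_div_two (k * (s - c)), Real.neg_pi_div_two_lt_arctan (k * (s - c)),
    Real.arctan_lt_pi_div_two (k * (0 - c)), Real.neg_pi_div_two_lt_arctan (k * (0 - c))]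

theorem deriv_arctanTruncation {k : ℝ} (hk : 0 < k) (c : ℝ) :
    deriv (arctanTruncation c k) = fun s => 1 / (1 + (k * (s - c)) ^ 2) := by
  funext s
  have h1 : HasDerivAt (fun s => k * (s - c)) k s := by
    simpa using ((hasDerivAt_id s).sub_const c).const_mul k
  have h2 := (h1.arctan.sub_const (Real.arctan (k * (0 - c)))).const_mul k⁻¹
  refine (HasDerivAt.deriv (f := arctanTruncation c k) h2).trans ?_
  field_simp

theorem contDiff_arctanTruncation (c k : ℝ) : ContDiff ℝ 1 (arctanTruncation c k) := by
  unfold arctanTruncation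
  exact contDiff_const.mul ((Real.contDiff_arctan.comp (by fun_prop)).sub contDiff_const)

theorem abs_deriv_arctanTruncation_le {k : ℝ} (hk : 0 < k) (c s : ℝ) :
    |deriv (arctanTruncation c k) s| ≤ 1 := by
  rw [deriv_arctanTruncation hk, abs_of_nonneg (by positivity), div_le_one (by positivity)]
  nlinarith [sq_nonneg (k * (s - c))]

theorem lipschitzWith_arctanTruncation {k : ℝ} (hk : 0 < k) (c : ℝ) :
    LipschitzWith 1 (arctanTruncation c k) := by
  refine lipschitzWith_of_nnnorm_deriv_le
    ((contDiff_arctanTruncation c k).differentiable (by simp)) fun s => ?_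
  exact abs_deriv_arctanTruncation_le hk c s

/-- The function `1 / (1 + x²)` is `1`-Lipschitz because `|x + y| ≤ (1 + x²)(1 + y²)`. This makes `u
↦ G'(u)` continuous on `L²`, as the chain rule for `H¹₀(Ω)` requires. -/
theorem lipschitzWith_deriv_arctanTruncation {k : ℝ} (hk : 0 < k) (c : ℝ) :
    LipschitzWith k.toNNReal (deriv (arctanTruncation c k)) := by
  refine LipschitzWith.of_dist_le_mul fun s t => ?_
  rw [deriv_arctanTruncation hk, Real.coe_toNNReal k hk.le, Real.dist_eq, Real.dist_eq]
  have key : ∀ x y : ℝ, |1 / (1 + x ^ 2) - 1 / (1 + y ^ 2)| ≤ |x - y| := by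
    intro x y
    have hx : 0 < 1 + x ^ 2 := by positivity
    have hy : 0 < 1 + y ^ 2 := by positivity
    rw [div_sub_div _ _ hx.ne' hy.ne', abs_div, abs_of_pos (mul_pos hx hy),
      div_le_iff₀ (mul_pos hx hy)]
    have e : 1 * (1 + y ^ 2) - (1 + x ^ 2) * 1 = -((x - y) * (x + y)) := by ring
    rw [e, abs_neg, abs_mul]
    refine mul_le_mul_of_nonneg_left ?_ (abs_nonneg _)
    rw [abs_le]
    constructor <;>
    nlinarith [sq_nonneg (x * y), sq_nonneg (x - 1), sq_nonneg (y - 1), sq_nonneg (x + 1),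
      sq_nonneg (y + 1), mul_nonneg (sq_nonneg x) (sq_nonneg y)]
  refine (key _ _).trans (le_of_eq ?_)
  rw [← mul_sub, abs_mul, abs_of_pos hk]
  congr 2
  ring

theorem tendsto_deriv_arctanTruncation (c s : ℝ) :
    Tendsto (fun n : ℕ => deriv (arctanTruncation c ((n : ℝ) + 1)) s) atTop
      (𝓝 (if s = c then 1 else 0)) := by
  have hd : ∀ n : ℕ, deriv (arctanTruncation c ((n : ℝ) + 1)) s =
      1 / (1 + (((n : ℝ) + 1) * (s - c)) ^ 2) := fun n =>
    congrFun (deriv_arctanTruncation (by positivity) c) s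
  simp only [hd]
  split_ifs with h
  · simp [h]
  · have h1 : Tendsto (fun n : ℕ => ((n : ℝ) + 1) ^ 2) atTop atTop :=
      (tendsto_pow_atTop two_ne_zero).comp
        (tendsto_atTop_add_const_right _ 1 tendsto_natCast_atTop_atTop)
    have h2 : Tendsto (fun n : ℕ => 1 + (((n : ℝ) + 1) * (s - c)) ^ 2) atTop atTop := by
      simp only [mul_pow]
      exact tendsto_atTop_add_const_left _ 1
        (h1.atTop_mul_const (by positivity [sub_ne_zero.2 h]))
    simp only [one_div]
    exact h2.inv_tendsto_atTop

end ArctanTruncation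

/-! ### Continuity in `L²` of composition integrals -/

section LpContinuity

variable {α E : Type*} [MeasurableSpace α] {μ : Measure α} [NormedAddCommGroup E]
  [InnerProductSpace ℝ E]

theorem continuous_integral_comp_mul {G : ℝ → ℝ} {K : ℝ≥0} (hG0 : G 0 = 0)
    (hK : LipschitzWith K G) {h : α → ℝ} (hh : MemLp h 2 μ) :
    Continuous fun u : Lp ℝ 2 μ => ∫ x, G (u x) * h x ∂μ := by
  have hc : Continuous fun u : Lp ℝ 2 μ => (inner ℝ (hh.toLp h) (hK.compLp hG0 u) : ℝ) :=
    continuous_const.inner (hK.continuous_compLp hG0)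
  refine hc.congr fun u => ?_
  rw [L2.inner_def]
  refine integral_congr_ae ?_
  filter_upwards [hh.coeFn_toLp, hK.coeFn_compLp hG0 u] with x e1 e2
  rw [e1, e2]
  rfl

/-- As `g 0` may be nonzero, `g` is split into `g - g 0`, which acts continuously on `L²`, and a
constant, which lies in `L²` because the measure is finite. Boundedness of `φ` keeps the other
factor in `L²`. -/
theorem continuous_integral_comp_mul_inner [IsFiniteMeasure μ] {g : ℝ → ℝ} {K : ℝ≥0}
    (hK : LipschitzWith K g) {φ : α → ℝ} (hφ : MemLp φ ∞ μ) (v : E) :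
    Continuous fun q : Lp ℝ 2 μ × Lp E 2 μ => ∫ x, g (q.1 x) * (inner ℝ (q.2 x) v * φ x) ∂μ := by
  have hK0 : LipschitzWith K fun s => g s - g 0 := by
    simpa using hK.sub (LipschitzWith.const (g 0))
  have h0 : g 0 - g 0 = 0 := sub_self _
  let B : ℝ →L[ℝ] E →L[ℝ] ℝ := (1 : ℝ →L[ℝ] ℝ).smulRight (innerSL ℝ v)
  let T : Lp E 2 μ →L[ℝ] Lp ℝ 2 μ := B.holderL μ ∞ 2 2 (hφ.toLp φ)
  have hT : ∀ f : Lp E 2 μ, T f =ᵐ[μ] fun x => inner ℝ (f x) v * φ x := by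
    intro f
    refine (B.coeFn_holder (r := 2) (hφ.toLp φ) f).trans ?_
    filter_upwards [hφ.coeFn_toLp] with x hx
    rw [hx, real_inner_comm]
    exact mul_comm _ _
  have hc : Continuous fun q : Lp ℝ 2 μ × Lp E 2 μ =>
      (inner ℝ (T q.2) (hK0.compLp h0 q.1 + Lp.const 2 μ (g 0)) : ℝ) :=
    (T.continuous.comp continuous_snd).inner
      (((hK0.continuous_compLp h0).comp continuous_fst).add continuous_const)
  refine hc.congr fun q => ?_
  rw [L2.inner_def]
  refine integral_congr_ae ?_
  filter_upwards [hT q.2, hK0.coeFn_compLp h0 q.1, Lp.coeFn_const (p := 2) μ (g 0),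
    Lp.coeFn_add (hK0.compLp h0 q.1) (Lp.const 2 μ (g 0))] with x e1 e2 e3 e4
  rw [e1, e4, Pi.add_apply, e2, e3, Function.comp_apply, Function.const_apply, sub_add_cancel]
  rfl

end LpContinuity

/-! ### Chain rule, gradients on level sets and the Poincaré inequality -/

namespace DiffusionDomain

open Filter Topology

variable {N : ℕ} (D : DiffusionDomain N)

/-- Integrals over `Ω` against functions supported in `Ω`. -/
theorem setIntegral_Ω_eq {f : EuclideanSpace ℝ (Fin N) → ℝ} (φ : 𝓓(D.Ω, ℝ))
    (h : ∀ x, x ∉ tsupport φ → f x = 0) :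
    ∫ x in (D.Ω : Set (EuclideanSpace ℝ (Fin N))), f x = ∫ x, f x :=
  setIntegral_eq_integral_of_forall_compl_eq_zero fun x hx =>
    h x fun hx' => hx (φ.tsupport_subset hx')

/-- The chain rule for elements of `H¹₀(Ω)`, in weak form. -/
theorem integral_comp_mul_fderiv_eq {G : ℝ → ℝ} {K K' : ℝ≥0} (hG : ContDiff ℝ 1 G) (hG0 : G 0 = 0)
    (hK : LipschitzWith K G) (hK' : LipschitzWith K' (deriv G)) {p : D.L2Pair} (hp : p ∈ D.H10)
    (φ : 𝓓(D.Ω, ℝ)) (v : EuclideanSpace ℝ (Fin N)) :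
    ∫ x in (D.Ω : Set (EuclideanSpace ℝ (Fin N))), G (p.fst x) * fderiv ℝ φ x v =
      -∫ x in (D.Ω : Set (EuclideanSpace ℝ (Fin N))),
        deriv G (p.fst x) * (inner ℝ (p.snd x) v * φ x) := by
  have hφd : ContDiff ℝ 1 φ := φ.contDiff.of_le (by simp)
  have hdc : Continuous (fun x => fderiv ℝ φ x v) :=
    (hφd.continuous_fderiv (by simp)).clm_apply continuous_const
  have hds : HasCompactSupport (fun x => fderiv ℝ φ x v) :=
    φ.hasCompactSupport.fderiv_apply (𝕜 := ℝ) v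
  have h1 : MemLp (fun x => fderiv ℝ φ x v) 2
      (volume.restrict (D.Ω : Set (EuclideanSpace ℝ (Fin N)))) :=
    (hdc.memLp_of_hasCompactSupport hds).restrict _
  have h2 : MemLp φ ∞ (volume.restrict (D.Ω : Set (EuclideanSpace ℝ (Fin N)))) :=
    (φ.continuous.memLp_of_hasCompactSupport φ.hasCompactSupport).restrict _
  have hfst : Continuous fun q : D.L2Pair => q.fst := (WithLp.fstL 2 ℝ D.L2 D.L2Vec).continuous
  have hsnd : Continuous fun q : D.L2Pair => q.snd := (WithLp.sndL 2 ℝ D.L2 D.L2Vec).continuous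
  have hc₁ := (continuous_integral_comp_mul hG0 hK h1).comp hfst
  have hc₂ := (continuous_integral_comp_mul_inner hK' h2 v).comp (hfst.prodMk hsnd)
  -- Both sides are continuous in the pair, so it is enough to integrate by parts classically for
  -- test functions.
  refine D.H10_induction (isClosed_eq hc₁ hc₂.neg) ?_ hp
  rintro q ⟨ψ, hq1, hq2⟩
  have hψd : ContDiff ℝ 1 ψ := ψ.contDiff.of_le (by simp)
  have hGψ : ContDiff ℝ 1 fun x => G (ψ x) := hG.comp hψd
  have hfd : ∀ x, fderiv ℝ (fun x => G (ψ x)) x v = deriv G (ψ x) * fderiv ℝ ψ x v := by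
    intro x
    have e := ((hG.differentiable (by simp) (ψ x)).hasDerivAt.comp_hasFDerivAt x
      (hψd.differentiable (by simp) x).hasFDerivAt).fderiv
    have e' : fderiv ℝ (fun x => G (ψ x)) x = deriv G (ψ x) • fderiv ℝ ψ x := e
    rw [e']; rfl
  have e1 : ∫ x in (D.Ω : Set (EuclideanSpace ℝ (Fin N))), G (q.fst x) * fderiv ℝ φ x v
      = ∫ x, G (ψ x) * fderiv ℝ φ x v := by
    rw [← D.setIntegral_Ω_eq φ]
    · refine integral_congr_ae ?_
      filter_upwards [hq1] with x hx
      rw [hx]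
    · intro x hx
      rw [fderiv_of_notMem_tsupport ℝ hx]; simp
  have e2 : ∫ x in (D.Ω : Set (EuclideanSpace ℝ (Fin N))),
      deriv G (q.fst x) * (inner ℝ (q.snd x) v * φ x)
      = ∫ x, fderiv ℝ (fun x => G (ψ x)) x v * φ x := by
    rw [← D.setIntegral_Ω_eq φ]
    · refine integral_congr_ae ?_
      filter_upwards [hq1, hq2] with x h3 h4
      rw [h3, h4, hfd, gradient, InnerProductSpace.toDual_symm_apply, mul_assoc]
    · intro x hx
      rw [image_eq_zero_of_notMem_tsupport hx, mul_zero]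
  have hGc : Continuous (fun x => fderiv ℝ (fun x => G (ψ x)) x v) :=
    (hGψ.continuous_fderiv (by simp)).clm_apply continuous_const
  refine e1.trans (Eq.trans ?_ (congrArg Neg.neg e2.symm))
  rw [integral_mul_fderiv_eq_neg_fderiv_mul_of_integrable]
  · exact (hGc.mul φ.continuous).integrable_of_hasCompactSupport φ.hasCompactSupport.mul_left
  · exact (hGψ.continuous.mul hdc).integrable_of_hasCompactSupport hds.mul_left
  · exact (hGψ.continuous.mul φ.continuous).integrable_of_hasCompactSupport
      φ.hasCompactSupport.mul_left
  · exact fun x _ => hGψ.differentiable (by simp) x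
  · exact fun x _ => hφd.differentiable (by simp) x

theorem integrable_inner_mul_testFunction (g : D.L2Vec) (φ : 𝓓(D.Ω, ℝ))
    (v : EuclideanSpace ℝ (Fin N)) :
    Integrable (fun x => inner ℝ (g x) v * φ x)
      (volume.restrict (D.Ω : Set (EuclideanSpace ℝ (Fin N)))) := by
  obtain ⟨b, hb⟩ := φ.continuous.bounded_above_of_compact_support φ.hasCompactSupport
  exact (((Lp.memLp g).integrable (by norm_num)).inner_const v).mul_bdd (c := b)
    φ.continuous.aestronglyMeasurable (Eventually.of_forall hb)

/-- The gradient of an element of `H¹₀(Ω)` vanishes almost everywhere on its level sets. -/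
theorem snd_eq_zero_of_fst_eq {p : D.L2Pair} (hp : p ∈ D.H10) (c : ℝ) :
    ∀ᵐ x ∂(volume.restrict (D.Ω : Set (EuclideanSpace ℝ (Fin N)))), p.fst x = c → p.snd x = 0 := by
  let S : Set (EuclideanSpace ℝ (Fin N)) := {x | p.fst x = c}
  have hS : MeasurableSet S :=
    (Lp.stronglyMeasurable p.fst).measurable (measurableSet_singleton c)
  have hi : IntegrableOn (S.indicator p.snd) (D.Ω : Set (EuclideanSpace ℝ (Fin N))) :=
    ((Lp.memLp p.snd).integrable (by norm_num)).indicator hS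
  have h0 := D.ae_eq_zero_of_forall_testFunction hi fun φ v => ?_
  · filter_upwards [h0] with x hx hxc
    rwa [indicator_of_mem (show x ∈ S from hxc)] at hx
  have hφd : ContDiff ℝ 1 φ := φ.contDiff.of_le (by simp)
  have hdi : Integrable (fun x => fderiv ℝ φ x v)
      (volume.restrict (D.Ω : Set (EuclideanSpace ℝ (Fin N)))) :=
    (((hφd.continuous_fderiv (by simp)).clm_apply
      continuous_const).integrable_of_hasCompactSupport
      (φ.hasCompactSupport.fderiv_apply (𝕜 := ℝ) v)).restrict
  have hk : ∀ n : ℕ, (0 : ℝ) < (n : ℝ) + 1 := fun n => by positivity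
  -- The truncations tend uniformly to `0` while their derivatives tend boundedly to the indicator
  -- of `{c}`. In the limit the chain rule says that the gradient restricted to the level set is
  -- orthogonal to every test function.
  have hchain := fun n : ℕ => D.integral_comp_mul_fderiv_eq
    (contDiff_arctanTruncation c ((n : ℝ) + 1)) (arctanTruncation_zero c _)
    (lipschitzWith_arctanTruncation (hk n) c) (lipschitzWith_deriv_arctanTruncation (hk n) c)
    hp φ v
  have hL : Tendsto (fun n : ℕ => ∫ x in (D.Ω : Set (EuclideanSpace ℝ (Fin N))),
      arctanTruncation c ((n : ℝ) + 1) (p.fst x) * fderiv ℝ φ x v) atTop (𝓝 0) := by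
    refine squeeze_zero_norm (a := fun n : ℕ => 1 / ((n : ℝ) + 1) * (Real.pi *
      ∫ x in (D.Ω : Set (EuclideanSpace ℝ (Fin N))), ‖fderiv ℝ φ x v‖)) (fun n => ?_) ?_
    · rw [← mul_assoc, ← integral_const_mul]
      refine norm_integral_le_of_norm_le (hdi.norm.const_mul _) (Eventually.of_forall fun x => ?_)
      rw [norm_mul, one_div]
      exact mul_le_mul_of_nonneg_right (abs_arctanTruncation_le (hk n) c _) (norm_nonneg _)
    · simpa using tendsto_one_div_add_atTop_nhds_zero_nat.mul_const
        (Real.pi * ∫ x in (D.Ω : Set (EuclideanSpace ℝ (Fin N))), ‖fderiv ℝ φ x v‖)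
  have hR : Tendsto (fun n : ℕ => ∫ x in (D.Ω : Set (EuclideanSpace ℝ (Fin N))),
      deriv (arctanTruncation c ((n : ℝ) + 1)) (p.fst x) * (inner ℝ (p.snd x) v * φ x)) atTop
      (𝓝 (∫ x in (D.Ω : Set (EuclideanSpace ℝ (Fin N))),
        inner ℝ (S.indicator p.snd x) v * φ x)) := by
    have hint := D.integrable_inner_mul_testFunction p.snd φ v
    refine tendsto_integral_of_dominated_convergence
      (fun x => ‖inner ℝ (p.snd x) v * φ x‖) (fun n => ?_) hint.norm (fun n => ?_) ?_
    · exact (((contDiff_arctanTruncation c _).continuous_deriv le_rfl).comp_aestronglyMeasurable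
        (Lp.stronglyMeasurable p.fst).aestronglyMeasurable).mul hint.1
    · refine Eventually.of_forall fun x => ?_
      rw [norm_mul]
      exact mul_le_of_le_one_left (norm_nonneg _) (abs_deriv_arctanTruncation_le (hk n) c _)
    · refine Eventually.of_forall fun x => ?_
      have := (tendsto_deriv_arctanTruncation c (p.fst x)).mul_const (inner ℝ (p.snd x) v * φ x)
      by_cases hx : p.fst x = c
      · rw [indicator_of_mem (show x ∈ S from hx)]
        simpa [hx] using this
      · rw [indicator_of_notMem (show x ∉ S from hx)]
        simpa [hx] using this
  have hfin := tendsto_nhds_unique (hL.congr hchain) hR.neg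
  linarith

/-- The Poincaré inequality for test functions. -/
theorem integral_sq_le_of_testFunction {R : ℝ}
    (hR : ∀ x ∈ (D.Ω : Set (EuclideanSpace ℝ (Fin N))), ‖x‖ ≤ R) (φ : 𝓓(D.Ω, ℝ))
    {e : EuclideanSpace ℝ (Fin N)} (he : ‖e‖ = 1) :
    ∫ x in (D.Ω : Set (EuclideanSpace ℝ (Fin N))), φ x ^ 2 ≤
      4 * R ^ 2 * ∫ x in (D.Ω : Set (EuclideanSpace ℝ (Fin N))), ‖fderiv ℝ φ x‖ ^ 2 := by
  have hφd : ContDiff ℝ 1 φ := φ.contDiff.of_le (by simp)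
  have hdc : Continuous (fderiv ℝ φ) := hφd.continuous_fderiv (by simp)
  have hds : HasCompactSupport (fderiv ℝ φ) := φ.hasCompactSupport.fderiv (𝕜 := ℝ)
  have hsqd : ContDiff ℝ 1 fun x => φ x ^ 2 := hφd.pow 2
  have hsqs : HasCompactSupport fun x => φ x ^ 2 :=
    φ.hasCompactSupport.comp_left (g := fun s : ℝ => s ^ 2) (by simp)
  have hfd : ∀ x, fderiv ℝ (fun x => φ x ^ 2) x e = 2 * φ x * fderiv ℝ φ x e := by
    intro x
    have h := ((hφd.differentiable (by simp) x).hasFDerivAt.pow 2).fderiv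
    have h' : fderiv ℝ (fun x => φ x ^ 2) x = (2 • φ x ^ (2 - 1)) • fderiv ℝ φ x := h
    rw [h', smul_apply]
    simp
  have hfe : ∀ x, fderiv ℝ (fun x => inner ℝ e x) x e = 1 := by
    intro x
    have h' : fderiv ℝ (fun x => inner ℝ e x) x = innerSL ℝ e :=
      ((innerSL ℝ e).hasFDerivAt (x := x)).fderiv
    rw [h', innerSL_apply_apply, real_inner_self_eq_norm_sq, he, one_pow]
  have hlin : ContDiff ℝ 1 fun x : EuclideanSpace ℝ (Fin N) => inner ℝ e x :=
    (innerSL ℝ e).contDiff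
  have i0 : Integrable (fun x => 2 * φ x * fderiv ℝ φ x e * inner ℝ e x) :=
    (((φ.continuous.const_mul 2).mul (hdc.clm_apply continuous_const)).mul
        hlin.continuous).integrable_of_hasCompactSupport
          ((φ.hasCompactSupport.mul_left).mul_right.mul_right)
  -- Integration by parts against the coordinate `⟪e, x⟫`, whose derivative along `e` is `1` and
  -- which is bounded by `R` on `Ω`.
  have hibp : ∫ x, φ x ^ 2 = -∫ x, 2 * φ x * fderiv ℝ φ x e * inner ℝ e x := by
    have h := integral_mul_fderiv_eq_neg_fderiv_mul_of_integrable (μ := volume) (v := e)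
      (f := fun x => φ x ^ 2) (g := fun x : EuclideanSpace ℝ (Fin N) => inner ℝ e x) ?_ ?_ ?_
      (fun x _ => hsqd.differentiable (by simp) x) (fun x _ => hlin.differentiable (by simp) x)
    · simpa only [hfe, mul_one, hfd] using h
    · simpa only [hfd] using i0
    · simp only [hfe, mul_one]
      exact hsqd.continuous.integrable_of_hasCompactSupport hsqs
    · exact (hsqd.continuous.mul hlin.continuous).integrable_of_hasCompactSupport hsqs.mul_right
  have i1 : Integrable (fun x => φ x ^ 2)
      (volume.restrict (D.Ω : Set (EuclideanSpace ℝ (Fin N)))) :=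
    (hsqd.continuous.integrable_of_hasCompactSupport hsqs).restrict
  have hds2 : HasCompactSupport fun x => ‖fderiv ℝ φ x‖ ^ 2 := by
    refine hds.norm.comp_left (g := fun s : ℝ => s ^ 2) ?_
    exact zero_pow two_ne_zero
  have i2 : Integrable (fun x => ‖fderiv ℝ φ x‖ ^ 2)
      (volume.restrict (D.Ω : Set (EuclideanSpace ℝ (Fin N)))) :=
    (Continuous.integrable_of_hasCompactSupport (hdc.norm.pow 2) hds2).restrict
  have hkey : ∫ x in (D.Ω : Set (EuclideanSpace ℝ (Fin N))), φ x ^ 2 ≤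
      ∫ x in (D.Ω : Set (EuclideanSpace ℝ (Fin N))),
        (1 / 2 * φ x ^ 2 + 2 * R ^ 2 * ‖fderiv ℝ φ x‖ ^ 2) := by
    have s1 := D.setIntegral_Ω_eq (f := fun x => φ x ^ 2) φ fun x hx => by
      rw [image_eq_zero_of_notMem_tsupport hx, zero_pow two_ne_zero]
    have s2 := D.setIntegral_Ω_eq (f := fun x => 2 * φ x * fderiv ℝ φ x e * inner ℝ e x) φ
      fun x hx => by
        rw [image_eq_zero_of_notMem_tsupport hx, mul_zero, zero_mul, zero_mul]
    rw [s1, hibp, ← s2, ← integral_neg]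
    refine integral_mono_ae i0.restrict.neg ((i1.const_mul _).add (i2.const_mul _)) ?_
    filter_upwards [ae_restrict_mem D.Ω.isOpen.measurableSet] with x hx
    have b1 : |fderiv ℝ φ x e| ≤ ‖fderiv ℝ φ x‖ := by
      have := (fderiv ℝ φ x).le_opNorm e
      rwa [he, mul_one] at this
    have b2 : |inner ℝ e x| ≤ R := by
      refine (abs_real_inner_le_norm e x).trans ?_
      rw [he, one_mul]; exact hR x hx
    have b3 : |fderiv ℝ φ x e * inner ℝ e x| ≤ ‖fderiv ℝ φ x‖ * R := by
      rw [abs_mul]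
      exact mul_le_mul b1 b2 (abs_nonneg _) (norm_nonneg _)
    have b4 : (fderiv ℝ φ x e * inner ℝ e x) ^ 2 ≤ (‖fderiv ℝ φ x‖ * R) ^ 2 :=
      sq_le_sq' (abs_le.1 b3).1 (abs_le.1 b3).2
    change -(2 * φ x * fderiv ℝ φ x e * inner ℝ e x)
      ≤ 1 / 2 * φ x ^ 2 + 2 * R ^ 2 * ‖fderiv ℝ φ x‖ ^ 2
    -- Young's inequality `-2φX ≤ φ²/2 + 2X²`; absorbing the `φ²/2` afterwards gives the constant
    -- `4R²`.
    nlinarith [sq_nonneg (φ x + 2 * (fderiv ℝ φ x e * inner ℝ e x))]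
  rw [integral_add (i1.const_mul _) (i2.const_mul _), integral_const_mul, integral_const_mul]
    at hkey
  linarith

/-- The Poincaré inequality on `H¹₀(Ω)`. -/
theorem exists_norm_fst_le (hN : 1 ≤ N) :
    ∃ C : ℝ, 0 ≤ C ∧ ∀ p ∈ D.H10, ‖p.fst‖ ≤ C * ‖p.snd‖ := by
  obtain ⟨R, hR⟩ := D.isBounded_Ω.subset_closedBall 0
  have hR' : ∀ x ∈ (D.Ω : Set (EuclideanSpace ℝ (Fin N))), ‖x‖ ≤ R := fun x hx =>
    mem_closedBall_zero_iff.1 (hR hx)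
  obtain ⟨x₀, hx₀⟩ := D.isConnected_Ω.nonempty
  have hR0 : 0 ≤ R := (norm_nonneg x₀).trans (hR' x₀ hx₀)
  refine ⟨2 * R, by positivity, fun p hp => ?_⟩
  have hfst : Continuous fun q : D.L2Pair => q.fst := (WithLp.fstL 2 ℝ D.L2 D.L2Vec).continuous
  have hsnd : Continuous fun q : D.L2Pair => q.snd := (WithLp.sndL 2 ℝ D.L2 D.L2Vec).continuous
  refine D.H10_induction (P := fun q => ‖q.fst‖ ≤ 2 * R * ‖q.snd‖)
    (isClosed_le hfst.norm (continuous_const.mul hsnd.norm)) ?_ hp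
  rintro q ⟨φ, hq1, hq2⟩
  have h := D.integral_sq_le_of_testFunction hR' φ
    (e := EuclideanSpace.single ⟨0, hN⟩ 1) (by simp)
  have n1 : ‖q.fst‖ ^ 2 = ∫ x in (D.Ω : Set (EuclideanSpace ℝ (Fin N))), φ x ^ 2 := by
    rw [← real_inner_self_eq_norm_sq, L2.inner_def]
    refine integral_congr_ae ?_
    filter_upwards [hq1] with x hx
    rw [hx, real_inner_self_eq_norm_sq, Real.norm_eq_abs, sq_abs]
  have n2 : ‖q.snd‖ ^ 2 = ∫ x in (D.Ω : Set (EuclideanSpace ℝ (Fin N))), ‖fderiv ℝ φ x‖ ^ 2 := by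
    rw [← real_inner_self_eq_norm_sq, L2.inner_def]
    refine integral_congr_ae ?_
    filter_upwards [hq2] with x hx
    rw [hx, real_inner_self_eq_norm_sq, gradient, LinearIsometryEquiv.norm_map]
  rw [← n1, ← n2] at h
  refine (sq_le_sq₀ (norm_nonneg _) (by positivity)).1 (h.trans_eq ?_)
  ring

end DiffusionDomain

/-! ### Density of `𝓥` in `𝓗`, boundedness and coercivity of the form -/

namespace DiffusionDomain

open Filter Topology

variable {N : ℕ} (D : DiffusionDomain N)

theorem isClosed_iUnion_B : IsClosed (⋃ l, D.B l) := isClosed_iUnion_of_finite D.isClosed_B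

theorem isOpen_A : IsOpen D.A := D.Ω.isOpen.sdiff D.isClosed_iUnion_B

theorem A_subset_Ω : D.A ⊆ D.Ω := sdiff_subset

/-- The inclusion of `𝓥` into `𝓗`. -/
def inclusion : D.V →L[ℝ] D.H :=
  ((WithLp.fstL 2 ℝ D.L2 D.L2Vec).comp D.V.subtypeL).codRestrict D.H fun w => w.2.2

theorem coe_inclusion (w : D.V) : (D.inclusion w : D.L2) = D.toFun w := rfl

theorem inner_inclusion (u : D.H) (w : D.V) : inner ℝ u (D.inclusion w) =
    ∫ x in (D.Ω : Set (EuclideanSpace ℝ (Fin N))), (u : D.L2) x * D.toFun w x := by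
  rw [Submodule.coe_inner, L2.inner_def, coe_inclusion]
  exact integral_congr_ae (Eventually.of_forall fun x => mul_comm _ _)

theorem toDual_apply (u : D.H) (w : D.V) : D.toDual u w = inner ℝ u (D.inclusion w) := rfl

/-- Test functions that are constant on each `B_l` belong to `𝓥`. -/
theorem exists_toFun_eq_of_testFunction (φ : 𝓓(D.Ω, ℝ)) (c : Fin D.m → ℝ)
    (hc : ∀ l, ∀ x ∈ D.B l, φ x = c l) : ∃ w : D.V,
    ∀ᵐ x ∂(volume.restrict (D.Ω : Set (EuclideanSpace ℝ (Fin N)))), D.toFun w x = φ x := by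
  obtain ⟨p, hp, hpφ⟩ := D.exists_mem_testPairs φ
  refine ⟨⟨p, hp, fun l => ?_⟩, hpφ⟩
  have h1 : ∀ᵐ x ∂(volume.restrict (D.B l)), p.fst x = c l := by
    filter_upwards [ae_mono (Measure.restrict_mono (D.B_subset_Ω l) le_rfl) hpφ,
      ae_restrict_mem (D.isClosed_B l).measurableSet] with x h2 h3
    rw [h2, hc l x h3]
  have hav : ⨍ y in D.B l, p.fst y = c l := by
    rw [average_congr h1, setAverage_const (D.volume_B_pos l).ne'
      ((measure_mono (D.B_subset_Ω l)).trans_lt D.volume_Ω_lt_top).ne]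
  change ∀ᵐ x ∂(volume.restrict (D.B l)), p.fst x = ⨍ y in D.B l, p.fst y
  rw [hav]
  exact h1

theorem integral_mul_testFunction_eq_zero {u : D.H}
    (hu : ∀ w : D.V, inner ℝ u (D.inclusion w) = 0) (φ : 𝓓(D.Ω, ℝ)) (c : Fin D.m → ℝ)
    (hc : ∀ l, ∀ x ∈ D.B l, φ x = c l) :
    ∫ x in (D.Ω : Set (EuclideanSpace ℝ (Fin N))), φ x * (u : D.L2) x = 0 := by
  obtain ⟨w, hw⟩ := D.exists_toFun_eq_of_testFunction φ c hc
  rw [← hu w, inner_inclusion]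
  refine integral_congr_ae ?_
  filter_upwards [hw] with x hx
  rw [hx, mul_comm]

/-- A smooth function equal to `1` on `B_l`, vanishing on the other components. -/
theorem exists_testFunction_eq_one (l : Fin D.m) : ∃ φ : 𝓓(D.Ω, ℝ),
    (∀ x ∈ D.B l, φ x = 1) ∧ ∀ k, k ≠ l → ∀ x ∈ D.B k, φ x = 0 := by
  -- `U` omits the other components, and a compact set squeezed between the compact `B_l` and `U`
  -- houses the support of the cutoff.
  let U : Set (EuclideanSpace ℝ (Fin N)) := D.Ω \ ⋃ k : {k : Fin D.m // k ≠ l}, D.B k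
  have hU : IsOpen U :=
    D.Ω.isOpen.sdiff (isClosed_iUnion_of_finite fun k => D.isClosed_B k)
  have hBU : D.B l ⊆ U := by
    intro x hx
    refine ⟨D.B_subset_Ω l hx, fun hx' => ?_⟩
    obtain ⟨k, hk⟩ := mem_iUnion.1 hx'
    exact disjoint_left.1 (D.disjoint_B k l k.2) hk hx
  have hBc : IsCompact (D.B l) := Metric.isCompact_of_isClosed_isBounded (D.isClosed_B l)
    (D.isBounded_Ω.subset (D.B_subset_Ω l))
  obtain ⟨L, hL, hBL, hLU⟩ := exists_compact_between hBc hU hBU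
  obtain ⟨f, hf, -, hfs, hf1⟩ := exists_contMDiff_support_eq_eq_one_iff
    (n := ⊤) (modelWithCornersSelf ℝ (EuclideanSpace ℝ (Fin N)))
    (isOpen_interior (s := L)) (D.isClosed_B l) hBL
  have hts : tsupport f ⊆ L := by
    rw [tsupport, hfs]
    exact closure_minimal interior_subset hL.isClosed
  refine ⟨⟨f, hf.contDiff, hL.of_isClosed_subset (isClosed_tsupport f) hts,
    fun x hx => (hLU (hts hx)).1⟩, fun x hx => (hf1 x).1 hx, fun k hk x hx => ?_⟩
  refine image_eq_zero_of_notMem_tsupport (f := f) fun hx' => ?_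
  exact (hLU (hts hx')).2 (mem_iUnion.2 ⟨⟨k, hk⟩, hx⟩)

/-- `𝓥` is dense in `𝓗`. -/
theorem eq_zero_of_forall_inner_inclusion {u : D.H}
    (hu : ∀ w : D.V, inner ℝ u (D.inclusion w) = 0) : u = 0 := by
  have hui : IntegrableOn (u : D.L2) (D.Ω : Set (EuclideanSpace ℝ (Fin N))) :=
    (Lp.memLp (u : D.L2)).integrable (by norm_num)
  have hA : ∀ᵐ x, x ∈ D.A → (u : D.L2) x = 0 := by
    refine D.isOpen_A.ae_eq_zero_of_integral_contDiff_smul_eq_zero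
      (hui.mono_set D.A_subset_Ω).locallyIntegrableOn fun g hg hgc hgs => ?_
    let φ : 𝓓(D.Ω, ℝ) := ⟨g, hg, hgc, hgs.trans D.A_subset_Ω⟩
    rw [← D.integral_mul_testFunction_eq_zero hu φ (fun _ => 0) fun l x hx =>
      image_eq_zero_of_notMem_tsupport (f := g) fun hx' => (hgs hx').2 (mem_iUnion.2 ⟨l, hx⟩)]
    refine (D.setIntegral_Ω_eq φ fun x hx => ?_).symm
    rw [image_eq_zero_of_notMem_tsupport (f := g) hx, zero_smul]
  have hB : ∀ l, ∀ᵐ x, x ∈ D.B l → (u : D.L2) x = 0 := by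
    intro l
    obtain ⟨φ, h1, h0⟩ := D.exists_testFunction_eq_one l
    have hint := D.integral_mul_testFunction_eq_zero hu φ (fun k => if k = l then 1 else 0)
      fun k x hx => by
        split_ifs with hk
        · subst hk; exact h1 x hx
        · exact h0 k hk x hx
    have hul := u.2 l
    rw [ae_restrict_iff' (D.isClosed_B l).measurableSet] at hul
    -- As `u` already vanishes on `A`, the values of the cutoff between the components are
    -- irrelevant, and only `|B_l|` times the mean of `u` remains.
    have hind : ∫ x in (D.Ω : Set (EuclideanSpace ℝ (Fin N))), φ x * (u : D.L2) x =
        ∫ x in (D.Ω : Set (EuclideanSpace ℝ (Fin N))),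
          (D.B l).indicator (fun _ => ⨍ y in D.B l, (u : D.L2) y) x := by
      refine setIntegral_congr_ae D.Ω.isOpen.measurableSet ?_
      filter_upwards [hA, hul] with x hxA hxB hx
      by_cases hxl : x ∈ D.B l
      · rw [indicator_of_mem hxl, h1 x hxl, one_mul, hxB hxl]
      · rw [indicator_of_notMem hxl]
        by_cases hxU : x ∈ ⋃ k, D.B k
        · obtain ⟨k, hk⟩ := mem_iUnion.1 hxU
          rw [h0 k (fun h => hxl (h ▸ hk)) x hk, zero_mul]
        · rw [hxA ⟨hx, hxU⟩, mul_zero]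
    rw [hint, setIntegral_indicator (D.isClosed_B l).measurableSet,
      inter_eq_self_of_subset_right (D.B_subset_Ω l), setIntegral_const, smul_eq_mul] at hind
    have hpos : 0 < volume.real (D.B l) :=
      ENNReal.toReal_pos (D.volume_B_pos l).ne'
        ((measure_mono (D.B_subset_Ω l)).trans_lt D.volume_Ω_lt_top).ne
    have hav : ⨍ y in D.B l, (u : D.L2) y = 0 :=
      (mul_eq_zero.1 hind.symm).resolve_left hpos.ne'
    filter_upwards [hul] with x hx hxl
    rw [hx hxl, hav]
  refine Subtype.ext (Lp.ext ?_)
  have h0 : (((0 : D.H) : D.L2) : EuclideanSpace ℝ (Fin N) → ℝ)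
      =ᵐ[volume.restrict (D.Ω : Set (EuclideanSpace ℝ (Fin N)))] 0 := Lp.coeFn_zero _ _ _
  filter_upwards [h0, ae_restrict_of_ae hA, ae_restrict_of_ae (ae_all_iff.2 hB),
    ae_restrict_mem D.Ω.isOpen.measurableSet] with x e1 e2 e3 hx
  rw [e1, Pi.zero_apply]
  by_cases hxU : x ∈ ⋃ k, D.B k
  · obtain ⟨k, hk⟩ := mem_iUnion.1 hxU
    exact e3 k hk
  · exact e2 ⟨hx, hxU⟩

theorem restrict_restrict_A :
    (volume.restrict (D.Ω : Set (EuclideanSpace ℝ (Fin N)))).restrict D.A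
      = volume.restrict D.A :=
  Measure.restrict_restrict_of_subset D.A_subset_Ω

theorem memLp_sum_sum_smul {α F : Type*} [MeasurableSpace α] {μ : Measure α}
    [NormedAddCommGroup F] [NormedSpace ℝ F] {ι : Type*} [Fintype ι] {p : ℝ≥0∞}
    {m : α → ι → ι → ℝ} (hm : ∀ i j, MemLp (fun x => m x i j) p μ) (c : ι → ι → F) :
    MemLp (fun x => ∑ i, ∑ j, m x i j • c i j) p μ := by
  have h : ∀ i j, MemLp (fun x => m x i j • c i j) p μ := fun i j =>
    (ContinuousLinearMap.toSpanSingleton ℝ (c i j)).comp_memLp' (hm i j)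
  exact memLp_finsetSum _ fun i _ => memLp_finsetSum _ fun j _ => h i j

/-- A matrix field with bounded entries, as a bounded field of continuous linear maps. -/
theorem memLp_toContinuousLinearMap {α : Type*} [MeasurableSpace α] {μ : Measure α}
    {M : α → Matrix (Fin N) (Fin N) ℝ} (hM : ∀ i j, MemLp (fun x => M x i j) ∞ μ) :
    MemLp (fun x => LinearMap.toContinuousLinearMap (Matrix.toEuclideanLin (M x))) ∞ μ := by
  let L : Matrix (Fin N) (Fin N) ℝ →ₗ[ℝ]
      (EuclideanSpace ℝ (Fin N) →L[ℝ] EuclideanSpace ℝ (Fin N)) :=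
    (LinearMap.toContinuousLinearMap.toLinearMap).comp (Matrix.toEuclideanLin.toLinearMap)
  have hL : ∀ x, L (M x) = ∑ i, ∑ j, M x i j • L (Matrix.single i j 1) := by
    intro x
    nth_rewrite 1 [Matrix.matrix_eq_sum_single (M x)]
    simp only [map_sum]
    refine Finset.sum_congr rfl fun i _ => Finset.sum_congr rfl fun j _ => ?_
    rw [← map_smul, Matrix.smul_single, smul_eq_mul, mul_one]
  have h := memLp_sum_sum_smul hM fun i j => L (Matrix.single i j 1)
  simp only [← hL] at h
  exact h

/-- The bilinear form as a bounded bilinear map. -/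
theorem exists_continuousLinearMap_form
    {M : EuclideanSpace ℝ (Fin N) → Matrix (Fin N) (Fin N) ℝ}
    (hM : ∀ i j, MemLp (fun x => M x i j) ∞ (volume.restrict D.A)) :
    ∃ a : D.V →L[ℝ] D.V →L[ℝ] ℝ, ∀ u w, a u w = D.form M u w := by
  let E := EuclideanSpace ℝ (Fin N)
  let μ := (volume.restrict (D.Ω : Set E)).restrict D.A
  have hμ : μ = volume.restrict D.A := D.restrict_restrict_A
  have hM' := memLp_toContinuousLinearMap hM
  rw [← hμ] at hM'
  let T : D.V →L[ℝ] Lp E 2 μ :=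
    (LpToLpRestrictCLM E E ℝ (volume.restrict (D.Ω : Set E)) 2 D.A).comp
      ((WithLp.sndL 2 ℝ D.L2 D.L2Vec).comp D.V.subtypeL)
  have hT : ∀ w, T w =ᵐ[μ] D.grad w := fun w => LpToLpRestrictCLM_coeFn ℝ D.A (D.grad w)
  let Q : Lp E 2 μ →L[ℝ] Lp E 2 μ :=
    (ContinuousLinearMap.id ℝ (E →L[ℝ] E)).holderL μ ∞ 2 2 (hM'.toLp _)
  have hQ : ∀ g, Q g =ᵐ[μ] fun x => Matrix.toEuclideanLin (M x) (g x) := by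
    intro g
    refine ((ContinuousLinearMap.id ℝ (E →L[ℝ] E)).coeFn_holder (r := 2) (hM'.toLp _) g).trans ?_
    filter_upwards [hM'.coeFn_toLp] with x hx
    rw [hx]; rfl
  let a : D.V →L[ℝ] D.V →L[ℝ] ℝ :=
    (((innerSL ℝ).comp (Q.comp T) : D.V →L[ℝ] Lp E 2 μ →L[ℝ] ℝ)).bilinearComp
      (ContinuousLinearMap.id ℝ D.V) T
  refine ⟨a, fun u w => ?_⟩
  have ha : a u w = inner ℝ (Q (T u)) (T w) := rfl
  rw [ha, L2.inner_def, form, ← hμ]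
  refine integral_congr_ae ?_
  filter_upwards [hT u, hT w, hQ (T u)] with x h1 h2 h3
  rw [h3, h2, h1, real_inner_comm]

/-- Coercivity of the form on `𝓥`. -/
theorem isCoercive_form (hN : 1 ≤ N) {M : EuclideanSpace ℝ (Fin N) → Matrix (Fin N) (Fin N) ℝ}
    (hcoer : ∃ α : ℝ, 0 < α ∧ ∀ᵐ x ∂(volume.restrict D.A), ∀ ξ : EuclideanSpace ℝ (Fin N),
      α * ‖ξ‖ ^ 2 ≤ inner ℝ ξ (Matrix.toEuclideanLin (M x) ξ))
    {a : D.V →L[ℝ] D.V →L[ℝ] ℝ} (ha : ∀ u w, a u w = D.form M u w)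
    (hM : ∀ i j, MemLp (fun x => M x i j) ∞ (volume.restrict D.A)) : IsCoercive a := by
  obtain ⟨α, hα, hαM⟩ := hcoer
  obtain ⟨C, hC0, hC⟩ := D.exists_norm_fst_le hN
  -- The factor `C ^ 2 + 1` comes from `‖w‖² = ‖u‖² + ‖∇u‖²` and Poincaré with constant `C`.
  refine ⟨α / (C ^ 2 + 1), by positivity, fun w => ?_⟩
  have hg2 : Integrable (fun x => ‖D.grad w x‖ ^ 2)
      (volume.restrict (D.Ω : Set (EuclideanSpace ℝ (Fin N)))) :=
    (memLp_two_iff_integrable_sq_norm (Lp.memLp (D.grad w)).1).1 (Lp.memLp (D.grad w))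
  -- Off `A`, `w` takes one of finitely many constant values, and its gradient vanishes on the
  -- corresponding level sets.
  have hzero : ∀ᵐ x, x ∈ (D.Ω : Set (EuclideanSpace ℝ (Fin N))) → x ∉ D.A → D.grad w x = 0 := by
    have h1 : ∀ l, ∀ᵐ x, x ∈ D.B l → D.toFun w x = ⨍ y in D.B l, D.toFun w y := fun l =>
      (ae_restrict_iff' (D.isClosed_B l).measurableSet).1 (w.2.2 l)
    have h2 : ∀ l, ∀ᵐ x, x ∈ (D.Ω : Set (EuclideanSpace ℝ (Fin N))) →
        D.toFun w x = ⨍ y in D.B l, D.toFun w y → D.grad w x = 0 := fun l =>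
      (ae_restrict_iff' D.Ω.isOpen.measurableSet).1 (D.snd_eq_zero_of_fst_eq w.2.1 _)
    filter_upwards [ae_all_iff.2 h1, ae_all_iff.2 h2] with x e1 e2 hx hxA
    have hxU : x ∈ ⋃ l, D.B l := by
      by_contra h; exact hxA ⟨hx, h⟩
    obtain ⟨l, hl⟩ := mem_iUnion.1 hxU
    exact e2 l hx (e1 l hl)
  have hnorm : ‖D.grad w‖ ^ 2 = ∫ x in D.A, ‖D.grad w x‖ ^ 2 := by
    rw [← real_inner_self_eq_norm_sq, L2.inner_def]
    simp only [real_inner_self_eq_norm_sq]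
    refine setIntegral_eq_of_subset_of_ae_sdiff_eq_zero D.Ω.isOpen.measurableSet.nullMeasurableSet
      D.A_subset_Ω ?_
    filter_upwards [hzero] with x hx hxd
    rw [hx hxd.1 hxd.2]; simp
  have hform : α * ‖D.grad w‖ ^ 2 ≤ a w w := by
    rw [ha, hnorm, form, ← integral_const_mul]
    have hQ : Integrable (fun x => inner ℝ (D.grad w x) (Matrix.toEuclideanLin (M x) (D.grad w x)))
        (volume.restrict D.A) := by
      have hg : MemLp (D.grad w) 2 (volume.restrict D.A) :=
        (Lp.memLp (D.grad w)).mono_measure (Measure.restrict_mono D.A_subset_Ω le_rfl)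
      have hMg : MemLp (fun x => Matrix.toEuclideanLin (M x) (D.grad w x)) 2
          (volume.restrict D.A) :=
        MemLp.of_bilin (r := 2) (p := ∞) (q := 2)
          (fun (L : EuclideanSpace ℝ (Fin N) →L[ℝ] EuclideanSpace ℝ (Fin N)) ξ => L ξ) 1
          (memLp_toContinuousLinearMap hM) hg
          ((ContinuousLinearMap.id ℝ (EuclideanSpace ℝ (Fin N) →L[ℝ]
            EuclideanSpace ℝ (Fin N))).aestronglyMeasurable_comp₂
              (memLp_toContinuousLinearMap hM).1 hg.1)
          (Eventually.of_forall fun x => by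
            rw [one_mul]; exact ContinuousLinearMap.le_opNNNorm _ _)
      refine (L2.integrable_inner (𝕜 := ℝ) (hg.toLp _) (hMg.toLp _)).congr ?_
      filter_upwards [hg.coeFn_toLp, hMg.coeFn_toLp] with x h1 h2
      rw [h1, h2]
    refine integral_mono_ae ((hg2.mono_measure
      (Measure.restrict_mono D.A_subset_Ω le_rfl)).const_mul α) hQ ?_
    filter_upwards [hαM] with x hx using hx _
  have hV : ‖w‖ ^ 2 ≤ (C ^ 2 + 1) * ‖D.grad w‖ ^ 2 := by
    have h1 : ‖w‖ ^ 2 = ‖D.toFun w‖ ^ 2 + ‖D.grad w‖ ^ 2 :=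
      WithLp.prod_norm_sq_eq_of_L2 (w : D.L2Pair)
    have h2 : ‖D.toFun w‖ ≤ C * ‖D.grad w‖ := hC _ w.2.1
    have h3 : ‖D.toFun w‖ ^ 2 ≤ (C * ‖D.grad w‖) ^ 2 := by gcongr
    rw [h1]; linarith
  calc α / (C ^ 2 + 1) * ‖w‖ * ‖w‖ = α * (‖w‖ ^ 2 / (C ^ 2 + 1)) := by ring
    _ ≤ α * ‖D.grad w‖ ^ 2 := by
        refine mul_le_mul_of_nonneg_left ?_ hα.le
        rw [div_le_iff₀ (by positivity)]; linarith
    _ ≤ a w w := hform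

end DiffusionDomain

/-! ### Equivalence of weak and mild solutions -/

theorem integrable_testFunction_smul {E : Type*} [NormedAddCommGroup E] [NormedSpace ℝ E]
    (φ : 𝓓((⟨Ioi 0, isOpen_Ioi⟩ : Opens ℝ), ℝ)) {σ : ℝ → E}
    (hσ : MemLp σ 2 (volume.restrict (Ioi 0))) :
    Integrable (fun t => φ t • σ t) (volume.restrict (Ioi 0)) := by
  have hφ : MemLp φ 2 (volume.restrict (Ioi (0 : ℝ))) :=
    (φ.continuous.memLp_of_hasCompactSupport φ.hasCompactSupport).restrict _
  exact memLp_one_iff_integrable.1 (hσ.smul hφ)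

theorem integrable_deriv_testFunction_smul {E : Type*} [NormedAddCommGroup E] [NormedSpace ℝ E]
    (φ : 𝓓((⟨Ioi 0, isOpen_Ioi⟩ : Opens ℝ), ℝ)) {f : ℝ → E} (hf : Continuous f) :
    Integrable (fun t => deriv φ t • f t) (volume.restrict (Ioi 0)) := by
  have hd : ContDiff ℝ 1 φ := φ.contDiff.of_le (by simp)
  exact (((hd.continuous_deriv le_rfl).smul hf).integrable_of_hasCompactSupport
    φ.hasCompactSupport.deriv.smul_right).restrict

theorem memLp_clm_apply {V : Type*} [NormedAddCommGroup V] [NormedSpace ℝ V]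
    {μ : Measure ℝ} {p : ℝ≥0∞} {σ : ℝ → StrongDual ℝ V} (hσ : MemLp σ p μ) (w : V) :
    MemLp (fun t => σ t w) p μ :=
  (ContinuousLinearMap.apply ℝ ℝ w : StrongDual ℝ V →L[ℝ] ℝ).comp_memLp' hσ

theorem memLp_neg_clm_apply₂ {V : Type*} [NormedAddCommGroup V] [NormedSpace ℝ V]
    {μ : Measure ℝ} {p : ℝ≥0∞} (a : V →L[ℝ] V →L[ℝ] ℝ) {r : ℝ → V} (hr : MemLp r p μ) :
    MemLp (fun t => - a (r t)) p μ :=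
  (a.comp_memLp' hr).neg

/-- A distributional identity with values in a dual space can be tested against vectors. -/
theorem integral_deriv_smul_eq_iff_forall_apply {V : Type*} [NormedAddCommGroup V]
    [NormedSpace ℝ V] {F σ : ℝ → StrongDual ℝ V} (hF : Continuous F)
    (hσ : MemLp σ 2 (volume.restrict (Ioi 0))) (φ : 𝓓((⟨Ioi 0, isOpen_Ioi⟩ : Opens ℝ), ℝ)) :
    (∫ t in Ioi (0 : ℝ), deriv φ t • F t = - ∫ t in Ioi (0 : ℝ), φ t • σ t) ↔
      ∀ w : V, ∫ t in Ioi (0 : ℝ), deriv φ t * F t w = - ∫ t in Ioi (0 : ℝ), φ t * σ t w := by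
  rw [ContinuousLinearMap.ext_iff]
  refine forall_congr' fun w => ?_
  have h1 := ContinuousLinearMap.integral_apply (integrable_deriv_testFunction_smul φ hF) w
  have h2 := ContinuousLinearMap.integral_apply (integrable_testFunction_smul φ hσ) w
  simp only [FunLike.coe_smul, Pi.smul_apply, smul_eq_mul] at h1 h2
  rw [neg_apply, h1, h2]

namespace DiffusionDomain

open Filter Topology

variable {N : ℕ} (D : DiffusionDomain N)

theorem continuous_toDual : Continuous D.toDual :=
  ((innerSL ℝ (E := D.H)).continuous).clm_comp (continuous_const (y := D.inclusion))

/-- The `𝓥'`-valued distributional identity, tested against the elements of `𝓥`. -/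
theorem integral_deriv_smul_toDual_eq_iff (ρ : ℝ≥0 →ᵇ D.H) {σ : ℝ → StrongDual ℝ D.V}
    (hσ : MemLp σ 2 (volume.restrict (Ioi 0))) (φ : 𝓓((⟨Ioi 0, isOpen_Ioi⟩ : Opens ℝ), ℝ)) :
    (∫ t in Ioi (0 : ℝ), deriv φ t • D.toDual (ρ t.toNNReal) = - ∫ t in Ioi (0 : ℝ), φ t • σ t) ↔
      ∀ w : D.V, ∫ t in Ioi (0 : ℝ), deriv φ t * inner ℝ (ρ t.toNNReal) (D.inclusion w)
        = - ∫ t in Ioi (0 : ℝ), φ t * σ t w := by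
  simp only [← toDual_apply]
  exact integral_deriv_smul_eq_iff_forall_apply
    (D.continuous_toDual.comp (ρ.continuous.comp continuous_real_toNNReal)) hσ φ

/-- A weak solution is a mild solution of the abstract evolution equation. -/
theorem IsWeakSolution.isMildSolution {M : EuclideanSpace ℝ (Fin N) → Matrix (Fin N) (Fin N) ℝ}
    {ρin : D.H} {ρ : ℝ≥0 →ᵇ D.H} (h : D.IsWeakSolution M ρin ρ) {r : ℝ → D.V}
    (hr : D.IsL2Lift ρ r) {a : D.V →L[ℝ] D.V →L[ℝ] ℝ} (ha : ∀ u w, a u w = D.form M u w) :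
    IsMildSolution D.inclusion a (fun t => ρ t.toNNReal) r := by
  obtain ⟨⟨σ, hσ, hσρ⟩, -, r', hr', hweak⟩ := h
  have hcont : Continuous fun t : ℝ => ρ t.toNNReal :=
    ρ.continuous.comp continuous_real_toNNReal
  have hrr' : ∀ᵐ t ∂(volume.restrict (Ioi (0 : ℝ))), r t = r' t := by
    filter_upwards [hr.2, hr'.2] with t h1 h2
    exact D.toFun_injective (h1.trans h2.symm)
  refine ⟨hcont.continuousOn, fun T => hr.1.mono_measure
    (Measure.restrict_mono Ioc_subset_Ioi_self le_rfl), ?_, fun w t ht => ?_⟩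
  · filter_upwards [hr.2] with t ht
    exact Subtype.ext ht
  have hf : Continuous fun t : ℝ => inner ℝ (ρ t.toNNReal) (D.inclusion w) :=
    hcont.inner continuous_const
  have hb : ∀ t : ℝ, |inner ℝ (ρ t.toNNReal) (D.inclusion w)| ≤ ‖ρ‖ * ‖D.inclusion w‖ :=
    fun t => (abs_real_inner_le_norm _ _).trans
      (mul_le_mul_of_nonneg_right (ρ.norm_coe_le_norm _) (norm_nonneg _))
  have hg : ∀ T, IntegrableOn (fun t => σ t w) (Ioc 0 T) := fun T =>
    ((memLp_clm_apply (V := D.V) hσ w).mono_measure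
      (Measure.restrict_mono Ioc_subset_Ioi_self le_rfl)).integrable (by norm_num)
  -- The distributional derivative is essential here: an a.e. pointwise derivative alone would not
  -- determine the increments of a continuous function.
  have hfg : ∀ t : ℝ, 0 ≤ t → inner ℝ (ρ t.toNNReal) (D.inclusion w)
      - inner ℝ (ρ (0 : ℝ).toNNReal) (D.inclusion w) = ∫ s in (0 : ℝ)..t, σ s w :=
    fun t ht => sub_eq_integral_of_forall_testFunction hf hb hg
      (fun φ => (D.integral_deriv_smul_toDual_eq_iff ρ hσ φ).1 (hσρ φ) w) ht
  have hσa : ∀ᵐ t ∂(volume.restrict (Ioi (0 : ℝ))), σ t w = - a (r t) w := by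
    filter_upwards [ae_hasDerivAt_of_sub_eq_integral hg hfg, hweak w, hrr'] with t h1 h2 h3
    simp only [← inner_inclusion] at h2
    rw [h1.unique h2, h3, ha]
  rw [hfg t ht, ← intervalIntegral.integral_neg]
  refine intervalIntegral.integral_congr_ae_restrict ?_
  rw [uIoc_of_le ht]
  exact ae_mono (Measure.restrict_mono Ioc_subset_Ioi_self le_rfl) hσa

/-- A bounded mild solution is a weak solution. -/
theorem isWeakSolution_of_isMildSolution
    {M : EuclideanSpace ℝ (Fin N) → Matrix (Fin N) (Fin N) ℝ} {ρ : ℝ≥0 →ᵇ D.H} {r : ℝ → D.V}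
    {a : D.V →L[ℝ] D.V →L[ℝ] ℝ} (ha : ∀ u w, a u w = D.form M u w)
    (hr : MemLp r 2 (volume.restrict (Ioi 0)))
    (h : IsMildSolution D.inclusion a (fun t => ρ t.toNNReal) r) :
    D.IsWeakSolution M (ρ 0) ρ := by
  have hσ : MemLp (fun t => - a (r t)) 2 (volume.restrict (Ioi 0)) :=
    memLp_neg_clm_apply₂ a hr
  have hg : ∀ w T, IntegrableOn (fun t => - a (r t) w) (Ioc 0 T) := fun w T =>
    (h.integrableOn_apply w T).neg
  have hfg : ∀ w, ∀ t : ℝ, 0 ≤ t → inner ℝ (ρ t.toNNReal) (D.inclusion w)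
      - inner ℝ (ρ (0 : ℝ).toNNReal) (D.inclusion w) = ∫ s in (0 : ℝ)..t, - a (r s) w :=
    fun w t ht => by rw [intervalIntegral.integral_neg]; exact h.eqn w t ht
  refine ⟨⟨_, hσ, fun φ => (D.integral_deriv_smul_toDual_eq_iff ρ hσ φ).2 fun w =>
    integral_deriv_mul_eq_neg_of_sub_eq_integral (hg w) (hfg w) φ⟩, rfl, r, ⟨hr, ?_⟩, fun w => ?_⟩
  · filter_upwards [h.lift] with t ht
    exact congrArg Subtype.val ht
  · filter_upwards [ae_hasDerivAt_of_sub_eq_integral (hg w) (hfg w)] with t ht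
    simp only [← inner_inclusion, ← ha]
    exact ht

theorem norm_sq_eq_integral (u : D.H) :
    ‖u‖ ^ 2 = ∫ x in (D.Ω : Set (EuclideanSpace ℝ (Fin N))), (u : D.L2) x ^ 2 := by
  rw [← real_inner_self_eq_norm_sq, Submodule.coe_inner, L2.inner_def]
  simp only [real_inner_self_eq_norm_sq, Real.norm_eq_abs, sq_abs]

end DiffusionDomain

end

/-- The energy identity holds for any lift `r`. The integrability clause ensures that the
dissipation integral is not the default value `0` of a divergent integral. -/
theorem mainTheorem4 {N : ℕ} (hN : 1 ≤ N) (D : DiffusionDomain N)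
    (M : EuclideanSpace ℝ (Fin N) → Matrix (Fin N) (Fin N) ℝ)
    (hM : ∀ i j, MemLp (fun x => M x i j) ∞ (volume.restrict D.A))
    (hcoer : ∃ α : ℝ, 0 < α ∧ ∀ᵐ x ∂(volume.restrict D.A), ∀ ξ : EuclideanSpace ℝ (Fin N),
      α * ‖ξ‖ ^ 2 ≤ inner ℝ ξ (Matrix.toEuclideanLin (M x) ξ))
    (ρin : D.H) :
    (∃! ρ : ℝ≥0 →ᵇ D.H, D.IsWeakSolution M ρin ρ) ∧
    ∀ ρ : ℝ≥0 →ᵇ D.H, D.IsWeakSolution M ρin ρ →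
      ∀ r : ℝ → D.V, D.IsL2Lift ρ r → ∀ t : ℝ≥0,
        IntervalIntegrable (fun s => D.form M (r s) (r s)) volume 0 t ∧
        1 / 2 * (∫ x in (D.Ω : Set (EuclideanSpace ℝ (Fin N))), (ρ t : D.L2) x ^ 2)
          + (∫ s in (0 : ℝ)..t, D.form M (r s) (r s))
          = 1 / 2 * (∫ x in (D.Ω : Set (EuclideanSpace ℝ (Fin N))), (ρin : D.L2) x ^ 2) := by
  obtain ⟨a, ha⟩ := D.exists_continuousLinearMap_form hM
  have hcoer_a : IsCoercive a := D.isCoercive_form hN hcoer ha hM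
  refine ⟨?_, fun ρ hρ r hr t => ?_⟩
  · obtain ⟨ρ, r, hρ0, hr, hmild⟩ := exists_isMildSolution D.inclusion hcoer_a
      (fun _ hu => D.eq_zero_of_forall_inner_inclusion hu) ρin
    refine ⟨ρ, hρ0 ▸ D.isWeakSolution_of_isMildSolution ha hr hmild, fun ρ' hρ' => ?_⟩
    have hρ0' := hρ'.2.1
    obtain ⟨-, -, r', hr', -⟩ := id hρ'
    ext1 t
    have h := (hρ'.isMildSolution D hr' ha).eq_of_initial hcoer_a hmild
      (by simp [hρ0, hρ0']) t.coe_nonneg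
    simpa using h
  · have hmild := hρ.isMildSolution D hr ha
    have hint := hmild.integrableOn_self t
    have henergy := hmild.energy t.coe_nonneg
    simp only [Real.toNNReal_coe, Real.toNNReal_zero, hρ.2.1, D.norm_sq_eq_integral, ha]
      at hint henergy
    refine ⟨(intervalIntegrable_iff_integrableOn_Ioc_of_le t.coe_nonneg).2 hint, ?_⟩
    linarith
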